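/- For $\lambda>0$, a smooth compactly supported function $\psi:\mathbb R^3\to\mathbb C$ and $f\in L^4(\mathbb R)$ put $$T_\lambda^\psi f(x,y)=\int_{\mathbb R}e^{i\lambda(x^2t+yt^2)}\psi(x,y,t)f(t)\,dt,\qquad (x,y)\in\mathbb R^2 .$$ (i) For every such $\psi$ there is a constant $C_\psi$, depending only on $\psi$, such that for all $\lambda>0$ and all $f\in L^4(\mathbb R)$ one has $T_\lambda^\psi f\in L^4(\mathbb R^2)$ and $$\|T_\lambda^\psi f\|_{L^4(\mathbb R^2)}\le C_\psi\,\lambda^{-3/8}\,\|f\|_{L^4(\mathbb R)} .$$ (ii) The estimate is uniform over normalized cutoffs: let $\mathcal U$ be the set of smooth $\psi:\mathbb R^3\to\mathbb C$ with $\operatorname{supp}\psi\subset[-1,1]^3$ and $|\partial_t^j\psi|\le 1$ everywhere for $j=1,2,3$, and let $Q_4(\lambda)=\sup_{\psi\in\mathcal U}\,\sup_{\|f\|_{L^4(\mathbb R)}\le1}\|T_\lambda^\psi f\|_{L^4(\mathbb R^2)}$. Then there is an absolute constant $C$ with $Q_4(\lambda)\le C\lambda^{-3/8}$ for all $\lambda>0$.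 (iii) The exponent is sharp: let $\psi\ge 0$ be smooth with $\psi(x,y,t)=0$ for $|(x,y,t)|\ge1$ and $\psi(x,y,t)=1$ for $|(x,y,t)|\le\frac12$ (Euclidean norm). If, for some real $\delta$ and $C$, the inequality $\|T_\lambda^\psi f\|_{L^4(\mathbb R^2)}\le C\lambda^{-\delta}\|f\|_{L^4(\mathbb R)}$ holds for all sufficiently large $\lambda$ and all $f\in L^4(\mathbb R)$, then $\delta\le\frac38$. -/

import Mathlib

open MeasureTheory Filter
open scoped ENNReal ContDiff

noncomputable section

/-- The operator `T_λ^ψ f(x, y) = ∫ e^{iλ(x² t + y t²)} ψ(x, y, t) f(t) dt`. -/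
def oscOp (lam : ℝ) (ψ : ℝ × ℝ × ℝ → ℂ) (f : ℝ → ℂ) (z : ℝ × ℝ) : ℂ :=
  ∫ t : ℝ, Complex.exp (Complex.I * ((lam * (z.1 ^ 2 * t + z.2 * t ^ 2) : ℝ) : ℂ))
    * ψ (z.1, z.2, t) * f t

/-- The class `𝒰` of smooth cutoffs supported in `[-1,1]³` with `|∂_t^j ψ| ≤ 1` for `j = 1, 2, 3`. -/
def cutoffClass : Set (ℝ × ℝ × ℝ → ℂ) :=
  {ψ | ContDiff ℝ ∞ ψ ∧
    tsupport ψ ⊆ Set.Icc (-1) 1 ×ˢ (Set.Icc (-1) 1 ×ˢ Set.Icc (-1) 1) ∧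
    ∀ j ∈ ({1, 2, 3} : Set ℕ), ∀ x y t : ℝ, ‖iteratedDeriv j (fun s : ℝ => ψ (x, y, s)) t‖ ≤ 1}

/-- `Q_p(λ) = sup_{ψ ∈ 𝒰} sup_{‖f‖_p ≤ 1} ‖T_λ^ψ f‖_p`, as an extended nonnegative real. -/
def oscSup (p : ℝ≥0∞) (lam : ℝ) : ℝ≥0∞ :=
  ⨆ ψ ∈ cutoffClass, ⨆ (f : ℝ → ℂ) (_ : MemLp f p volume ∧ eLpNorm f p volume ≤ 1),
    eLpNorm (oscOp lam ψ f) p volume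

/-- The cutoffs used for optimality: smooth, nonnegative (in particular real-valued), equal to `0`
where `|(x,y,t)| ≥ 1` and to `1` where `|(x,y,t)| ≤ 1/2` (Euclidean norm). -/
structure IsTestCutoff (ψ : ℝ × ℝ × ℝ → ℂ) : Prop where
  smooth : ContDiff ℝ ∞ ψ
  nonneg : ∀ q, ∃ r : ℝ, 0 ≤ r ∧ ψ q = (r : ℂ)
  eq_zero : ∀ x y t : ℝ, 1 ≤ Real.sqrt (x ^ 2 + y ^ 2 + t ^ 2) → ψ (x, y, t) = 0
  eq_one : ∀ x y t : ℝ, Real.sqrt (x ^ 2 + y ^ 2 + t ^ 2) ≤ 1 / 2 → ψ (x, y, t) = 1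

end

/-!
# `L⁴` decay of the oscillatory operator with phase `x² t + y t²`

*Removal of the cutoff.* If `ψ` vanishes for `|t| ≥ R`, then `ψ(x, y, t)` is the integral of
`-∂_t ψ(x, y, s)` over `s ∈ [t, R]`, so `T f` is a superposition over `s` of the sharply cut
operators `parabExt` applied to `f 1_{t ≤ s}` (`oscOp_eq_integral_parabExt`). Only the size of the
support and of `∂_t ψ` enter, and this gives the uniformity over cutoffs. It remains to bound
`∫ |E g|⁴` over a box by `C lam ^ (-3/2) ∫ |g|⁴`, where `E g = parabExt lam R g`.

*The extension estimate.* Write `(E g)²` as an integral over pairs of frequencies `a = (t, s)`, with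
amplitude `g(t) g(s)` and phase `lam (x² (t + s) + y (t² + s²))`. Inserting the weight
`e^{-x² - y²}` and squaring out the `L²` norm leaves the kernel
`|lam (t + s - t' - s')| ^ (-1/2) e^{-lam² (t² + s² - t'² - s'²)² / 4}`, up to a constant
(`oscKernel`): the factor with exponent `-1/2` is the Fourier decay in `x²`, and the Gaussian
localizes to the circle `|a'| = |a|`. By Schur's test (`lintegral_enorm_sq_oscillatory_le`) only the
integral of the kernel in `a'` matters. In polar coordinates the angular integral is
`∫ |cos θ - c| ^ (-1/2) dθ ≤ C |1 - c²| ^ (-1/4)` (`lintegral_cos_sub_le`), and the radial integral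
then gives `C lam ^ (-3/2) |t - s| ^ (-1/2)` (`lintegral_oscKernel_le`). A second use of Schur's test
bounds `∫∫ |g(t)|² |g(s)|² |t - s| ^ (-1/2)` by `∫ |g|⁴`, because `|·| ^ (-1/2)` is locally
integrable.

*Sharpness.* For `f = 1_{[-1/4, 1/4]}` there is no cancellation when `|x| ≤ lam ^ (-1/2)` and
`|y| ≤ lam⁻¹`, a box of area comparable to `lam ^ (-3/2)`; hence `‖T f‖₄` is at least a multiple of
`lam ^ (-3/8)` (`le_lintegral_oscOp`).
-/

noncomputable section

/-! ### Schur's test for oscillatory integrals -/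

theorem mul_le_sq_add_sq (x y : ℝ≥0∞) : x * y ≤ x ^ 2 + y ^ 2 := by
  rcases le_total x y with h | h
  · calc x * y ≤ y * y := by gcongr
      _ = y ^ 2 := (sq y).symm
      _ ≤ _ := le_add_self
  · calc x * y ≤ x * x := by gcongr
      _ = x ^ 2 := (sq x).symm
      _ ≤ _ := le_self_add

/-- Schur's test for a symmetric kernel, by the pointwise bound `h(a) h(b) ≤ h(a)² + h(b)²`. -/
theorem lintegral_lintegral_mul_le_of_symm {α : Type*} [MeasurableSpace α] {ν : Measure α}
    [SFinite ν] {h : α → ℝ≥0∞} (hh : AEMeasurable h ν) {k : α → α → ℝ≥0∞}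
    (hk : Measurable (Function.uncurry k)) (hsymm : ∀ a b, k a b = k b a) :
    ∫⁻ p : α × α, h p.1 * h p.2 * k p.1 p.2 ∂(ν.prod ν) ≤
      2 * ∫⁻ a, h a ^ 2 * ∫⁻ b, k a b ∂ν ∂ν := by
  have hk' : Measurable fun p : α × α => k p.1 p.2 := hk
  have hka : ∀ a, Measurable fun b => k a b := fun a => hk'.comp measurable_prodMk_left
  have h1 : AEMeasurable (fun p : α × α => h p.1) (ν.prod ν) := hh.comp_fst
  have h2 : AEMeasurable (fun p : α × α => h p.2) (ν.prod ν) := hh.comp_snd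
  have m1 : AEMeasurable (fun p : α × α => h p.1 ^ 2 * k p.1 p.2) (ν.prod ν) :=
    (h1.pow_const 2).mul hk'.aemeasurable
  have m2 : AEMeasurable (fun p : α × α => h p.2 ^ 2 * k p.1 p.2) (ν.prod ν) :=
    (h2.pow_const 2).mul hk'.aemeasurable
  have e1 : ∫⁻ p : α × α, h p.1 ^ 2 * k p.1 p.2 ∂(ν.prod ν) =
      ∫⁻ a, h a ^ 2 * ∫⁻ b, k a b ∂ν ∂ν := by
    rw [lintegral_prod _ m1]
    refine lintegral_congr fun a => ?_
    exact lintegral_const_mul (h a ^ 2) (hka a)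
  have e2 : ∫⁻ p : α × α, h p.2 ^ 2 * k p.1 p.2 ∂(ν.prod ν) =
      ∫⁻ a, h a ^ 2 * ∫⁻ b, k a b ∂ν ∂ν := by
    rw [lintegral_prod_symm _ m2]
    refine lintegral_congr fun a => ?_
    simp only [hsymm _ a]
    exact lintegral_const_mul (h a ^ 2) (hka a)
  calc ∫⁻ p : α × α, h p.1 * h p.2 * k p.1 p.2 ∂(ν.prod ν)
      ≤ ∫⁻ p : α × α, (h p.1 ^ 2 * k p.1 p.2 + h p.2 ^ 2 * k p.1 p.2) ∂(ν.prod ν) := by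
        refine lintegral_mono fun p => ?_
        rw [← add_mul]
        gcongr
        exact mul_le_sq_add_sq _ _
    _ = _ := by
        rw [lintegral_add_left' m1, e1, e2, two_mul]

/-- Schur's test for an oscillatory integral operator `H ↦ ∫ e^{i P(z, a)} H(a) da`: squaring out
its `L²(m)` norm produces the kernel `∫ e^{i (P(z, a) - P(z, b))} dm(z)`, for which `k` is a
majorant. -/
theorem lintegral_enorm_sq_oscillatory_le {Z α : Type*} [MeasurableSpace Z] [MeasurableSpace α]
    {m : Measure Z} [IsFiniteMeasure m] {ν : Measure α} [SFinite ν] {P : Z → α → ℝ}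
    (hP : Measurable (Function.uncurry P)) {H : α → ℂ} (hH : Integrable H ν)
    {k : α → α → ℝ≥0∞} (hk : Measurable (Function.uncurry k)) (hsymm : ∀ a b, k a b = k b a)
    (hker : ∀ a b, ‖∫ z, Complex.exp (Complex.I * ((P z a - P z b : ℝ) : ℂ)) ∂m‖ₑ ≤ k a b) :
    ∫⁻ z, ‖∫ a, Complex.exp (Complex.I * (P z a : ℂ)) * H a ∂ν‖ₑ ^ 2 ∂m ≤
      2 * ∫⁻ a, ‖H a‖ₑ ^ 2 * ∫⁻ b, k a b ∂ν ∂ν := by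
  set Φ : Z → ℂ := fun z => ∫ a, Complex.exp (Complex.I * (P z a : ℂ)) * H a ∂ν with hΦ
  set G : Z → α × α → ℂ := fun z p =>
    Complex.exp (Complex.I * ((P z p.1 - P z p.2 : ℝ) : ℂ)) *
      (H p.1 * (starRingEnd ℂ) (H p.2)) with hG
  have hHH : Integrable (fun p : α × α => H p.1 * (starRingEnd ℂ) (H p.2)) (ν.prod ν) :=
    hH.mul_prod (LinearIsometryEquiv.integrable_comp_iff (Complex.conjLIE) |>.2 hH)
  -- Fubini is available since `m` is finite and the integrand has modulus `|H a| |H b|`.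
  have hGint : Integrable (Function.uncurry G) (m.prod (ν.prod ν)) := by
    refine Integrable.bdd_mul (c := 1) (hHH.comp_snd m) ?_ ?_
    · have hm : Measurable fun q : Z × α × α => P q.1 q.2.1 - P q.1 q.2.2 :=
        (hP.comp (measurable_fst.prodMk (measurable_fst.comp measurable_snd))).sub
          (hP.comp (measurable_fst.prodMk (measurable_snd.comp measurable_snd)))
      exact (by fun_prop : Measurable fun q : Z × α × α =>
        Complex.exp (Complex.I * ((P q.1 q.2.1 - P q.1 q.2.2 : ℝ) : ℂ))).aestronglyMeasurable
    · refine ae_of_all _ fun q => ?_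
      rw [mul_comm, Complex.norm_exp_ofReal_mul_I]
  have hΦG : ∀ z, ∫ p, G z p ∂(ν.prod ν) = Φ z * (starRingEnd ℂ) (Φ z) := by
    intro z
    rw [hΦ, ← integral_conj, ← integral_prod_mul]
    refine integral_congr_ae (ae_of_all _ fun p => ?_)
    simp only [hG, map_mul, ← Complex.exp_conj, Complex.conj_I, Complex.conj_ofReal]
    have : Complex.exp (Complex.I * ((P z p.1 - P z p.2 : ℝ) : ℂ)) =
        Complex.exp (Complex.I * (P z p.1 : ℂ)) * Complex.exp (-Complex.I * (P z p.2 : ℂ)) := by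
      rw [← Complex.exp_add]; congr 1; push_cast; ring
    rw [this]; ring
  have hsq : ∀ z, ∫ p, G z p ∂(ν.prod ν) = ((‖Φ z‖ ^ 2 : ℝ) : ℂ) := by
    intro z
    rw [hΦG, Complex.mul_conj, Complex.normSq_eq_norm_sq]
  have hint : Integrable (fun z => ((‖Φ z‖ ^ 2 : ℝ) : ℂ)) m := by
    simpa only [Function.uncurry_apply_pair, hsq] using hGint.integral_prod_left
  have hint' : Integrable (fun z => ‖Φ z‖ ^ 2) m := hint.re
  have hL : ∫⁻ z, ‖Φ z‖ₑ ^ 2 ∂m = ‖∫ z, ((‖Φ z‖ ^ 2 : ℝ) : ℂ) ∂m‖ₑ := by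
    rw [integral_complex_ofReal, ← ofReal_norm, Complex.norm_real, Real.norm_of_nonneg
      (integral_nonneg fun z => by positivity),
      ofReal_integral_eq_lintegral_ofReal hint' (ae_of_all _ fun z => by positivity)]
    refine lintegral_congr fun z => ?_
    rw [ENNReal.ofReal_pow (norm_nonneg _), ofReal_norm]
  calc ∫⁻ z, ‖Φ z‖ₑ ^ 2 ∂m = ‖∫ z, ∫ p, G z p ∂(ν.prod ν) ∂m‖ₑ := by
        rw [hL]; simp only [hsq]
    _ = ‖∫ p, (∫ z, G z p ∂m) ∂(ν.prod ν)‖ₑ := by rw [integral_integral_swap hGint]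
    _ ≤ ∫⁻ p, ‖∫ z, G z p ∂m‖ₑ ∂(ν.prod ν) := enorm_integral_le_lintegral_enorm _
    _ ≤ ∫⁻ p : α × α, ‖H p.1‖ₑ * ‖H p.2‖ₑ * k p.1 p.2 ∂(ν.prod ν) := by
        refine lintegral_mono fun p => ?_
        simp only [hG]
        rw [integral_mul_const, enorm_mul, enorm_mul, RCLike.enorm_conj, mul_comm]
        gcongr
        exact hker _ _
    _ ≤ _ := lintegral_lintegral_mul_le_of_symm hH.1.enorm hk hsymm

/-! ### Gaussian weights and their Fourier decay -/

/-- The measure `e^{-x²} dx` on the real line. -/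
def gaussWeight : Measure ℝ := volume.withDensity fun x => ENNReal.ofReal (Real.exp (-x ^ 2))

theorem measurable_gaussDensity : Measurable fun x : ℝ => ENNReal.ofReal (Real.exp (-x ^ 2)) := by
  fun_prop

instance : IsFiniteMeasure gaussWeight := by
  refine isFiniteMeasure_withDensity_ofReal (f := fun x : ℝ => Real.exp (-x ^ 2)) ?_
  have := (integrable_exp_neg_mul_sq (b := 1) one_pos).2
  simpa using this

theorem integral_gaussWeight (g : ℝ → ℂ) :
    ∫ x, g x ∂gaussWeight = ∫ x : ℝ, (Real.exp (-x ^ 2) : ℂ) * g x := by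
  rw [gaussWeight, integral_withDensity_eq_integral_toReal_smul measurable_gaussDensity
    (ae_of_all _ fun x => ENNReal.ofReal_lt_top)]
  refine integral_congr_ae (ae_of_all _ fun x => ?_)
  simp only [ENNReal.toReal_ofReal (Real.exp_pos _).le, Complex.real_smul]

theorem sqrt_pi_le_two : Real.sqrt Real.pi ≤ 2 := by
  rw [Real.sqrt_le_left (by norm_num)]
  linarith [Real.pi_le_four]

theorem norm_sqrt_pi_div (b : ℂ) :
    ‖((Real.pi : ℂ) / b) ^ (1 / 2 : ℂ)‖ = (Real.pi / ‖b‖) ^ (1 / 2 : ℝ) := by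
  have : (1 / 2 : ℂ) = ((1 / 2 : ℝ) : ℂ) := by push_cast; rfl
  rw [this, Complex.norm_cpow_real, norm_div, Complex.norm_real,
    Real.norm_of_nonneg Real.pi_pos.le]

/-- The power is taken in `ℝ≥0∞`, so that the bound is `⊤`, hence trivial, for `s = 0`. -/
theorem enorm_integral_gaussWeight_sq_le (s : ℝ) :
    ‖∫ x, Complex.exp (Complex.I * ((s * x ^ 2 : ℝ) : ℂ)) ∂gaussWeight‖ₑ ≤
      2 * ‖s‖ₑ ^ (-(1 / 2) : ℝ) := by
  rcases eq_or_ne s 0 with rfl | hs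
  · rw [enorm_zero, ENNReal.zero_rpow_of_neg (by norm_num), ENNReal.mul_top (by norm_num)]
    exact le_top
  have hre : (1 - Complex.I * s : ℂ).re = 1 := by simp
  have him : (1 - Complex.I * s : ℂ).im = -s := by simp
  have hI : ∫ x, Complex.exp (Complex.I * ((s * x ^ 2 : ℝ) : ℂ)) ∂gaussWeight =
      ((Real.pi : ℂ) / (1 - Complex.I * s)) ^ (1 / 2 : ℂ) := by
    rw [integral_gaussWeight, ← integral_gaussian_complex (by rw [hre]; exact one_pos)]
    refine integral_congr_ae (ae_of_all _ fun x => ?_)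
    simp only
    rw [Complex.ofReal_exp, ← Complex.exp_add]
    congr 1; push_cast; ring
  have hs' : 0 < |s| := abs_pos.2 hs
  rw [hI, ← ofReal_norm, norm_sqrt_pi_div, Real.enorm_eq_ofReal_abs,
    ENNReal.ofReal_rpow_of_pos hs',
    show (2 : ℝ≥0∞) = ENNReal.ofReal 2 by simp, ← ENNReal.ofReal_mul (by norm_num)]
  refine ENNReal.ofReal_le_ofReal ?_
  calc (Real.pi / ‖1 - Complex.I * s‖) ^ (1 / 2 : ℝ) ≤ (Real.pi / |s|) ^ (1 / 2 : ℝ) := by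
        have h1 : |s| ≤ ‖1 - Complex.I * s‖ := by
          have := Complex.abs_im_le_norm (1 - Complex.I * s)
          rwa [him, abs_neg] at this
        have := Real.pi_pos
        gcongr
    _ = Real.sqrt Real.pi * |s| ^ (-(1 / 2) : ℝ) := by
        rw [Real.div_rpow Real.pi_pos.le hs'.le, Real.rpow_neg hs'.le, Real.sqrt_eq_rpow]
        rfl
    _ ≤ 2 * |s| ^ (-(1 / 2) : ℝ) := by
        gcongr
        exact sqrt_pi_le_two

theorem enorm_integral_gaussWeight_linear_le (s : ℝ) :
    ‖∫ x, Complex.exp (Complex.I * ((s * x : ℝ) : ℂ)) ∂gaussWeight‖ₑ ≤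
      2 * ENNReal.ofReal (Real.exp (-s ^ 2 / 4)) := by
  have hI : ∫ x, Complex.exp (Complex.I * ((s * x : ℝ) : ℂ)) ∂gaussWeight =
      ((Real.pi : ℂ) / 1) ^ (1 / 2 : ℂ) * Complex.exp (-(s : ℂ) ^ 2 / (4 * 1)) := by
    rw [integral_gaussWeight, ← fourierIntegral_gaussian (by simp)]
    refine integral_congr_ae (ae_of_all _ fun x => ?_)
    simp only
    rw [mul_comm, Complex.ofReal_exp]
    congr 2
    · push_cast; ring
    · push_cast; ring
  have he : Complex.exp (-(s : ℂ) ^ 2 / (4 * 1)) = ((Real.exp (-s ^ 2 / 4) : ℝ) : ℂ) := by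
    push_cast; ring_nf
  rw [hI, he, enorm_mul, ← ofReal_norm, norm_sqrt_pi_div, ← ofReal_norm, Complex.norm_real,
    Real.norm_of_nonneg (Real.exp_pos _).le, show (2 : ℝ≥0∞) = ENNReal.ofReal 2 by simp]
  gcongr
  rw [norm_one, div_one, ← Real.sqrt_eq_rpow]
  exact sqrt_pi_le_two

/-! ### Power singularities on the line and on the circle -/

theorem ENNReal.rpow_le_rpow_of_exponent_nonpos {x y : ℝ≥0∞} {z : ℝ} (hz : z ≤ 0) (h : x ≤ y) :
    y ^ z ≤ x ^ z := by
  rw [← neg_neg z, ENNReal.rpow_neg y, ENNReal.rpow_neg x, ENNReal.inv_le_inv]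
  exact ENNReal.rpow_le_rpow h (neg_nonneg.2 hz)

theorem lintegral_Icc_enorm_rpow_neg_lt_top (R : ℝ) {α : ℝ} (hα : α < 1) :
    ∫⁻ u in Set.Icc (-R) R, ‖u‖ₑ ^ (-α) < ⊤ := by
  rcases lt_or_ge R 0 with hR | hR
  · rw [Set.Icc_eq_empty (by linarith)]; simp
  have hpos : ∫⁻ u in Set.Ioc 0 R, ‖u‖ₑ ^ (-α) < ⊤ := by
    have h := (intervalIntegral.intervalIntegrable_rpow' (a := 0) (b := R) (r := -α)
      (by linarith)).1.2
    rw [hasFiniteIntegral_iff_enorm] at h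
    refine lt_of_eq_of_lt (setLIntegral_congr_fun measurableSet_Ioc fun u hu => ?_) h
    rw [Real.enorm_eq_ofReal hu.1.le, Real.enorm_eq_ofReal (by have := hu.1; positivity),
      ENNReal.ofReal_rpow_of_pos hu.1]
  have hneg : ∫⁻ u in Set.Ico (-R) 0, ‖u‖ₑ ^ (-α) = ∫⁻ u in Set.Ioc 0 R, ‖u‖ₑ ^ (-α) := by
    rw [← lintegral_indicator measurableSet_Ico, ← lintegral_indicator measurableSet_Ioc,
      ← lintegral_neg_eq_self]
    refine lintegral_congr fun u => ?_
    by_cases hu : u ∈ Set.Ioc 0 R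
    · rw [Set.indicator_of_mem hu, Set.indicator_of_mem
        (show -u ∈ Set.Ico (-R) 0 from ⟨by linarith [hu.2], by linarith [hu.1]⟩),
        enorm_neg]
    · rw [Set.indicator_of_notMem hu, Set.indicator_of_notMem]
      rintro ⟨h1, h2⟩
      exact hu ⟨by linarith, by linarith⟩
  have hsub : Set.Icc (-R) R ⊆ (Set.Ico (-R) 0 ∪ Set.Ioc 0 R) ∪ {0} := by
    intro u hu
    rcases lt_trichotomy u 0 with h | h | h
    · exact Or.inl (Or.inl ⟨hu.1, h⟩)
    · exact Or.inr h
    · exact Or.inl (Or.inr ⟨h, hu.2⟩)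
  calc _ ≤ ∫⁻ u in (Set.Ico (-R) 0 ∪ Set.Ioc 0 R) ∪ {(0 : ℝ)}, ‖u‖ₑ ^ (-α) := lintegral_mono_set hsub
    _ ≤ ((∫⁻ u in Set.Ico (-R) 0, ‖u‖ₑ ^ (-α)) + ∫⁻ u in Set.Ioc 0 R, ‖u‖ₑ ^ (-α)) +
        ∫⁻ u in {(0 : ℝ)}, ‖u‖ₑ ^ (-α) := by
      refine (lintegral_union_le _ _ _).trans ?_
      gcongr
      exact lintegral_union_le _ _ _
    _ < ⊤ := by
      rw [hneg, Measure.restrict_singleton]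
      simp [hpos]

/-- A periodic function has the same integral over a period after a translation. -/
theorem lintegral_period_comp_sub {f : ℝ → ℝ≥0∞} (hf : Function.Periodic f (2 * Real.pi))
    (β : ℝ) :
    ∫⁻ θ in Set.Ioc (-Real.pi) Real.pi, f (θ - β) =
      ∫⁻ θ in Set.Ioc (-Real.pi) Real.pi, f θ := by
  have h2 : (0 : ℝ) < 2 * Real.pi := by positivity
  have e1 : ∫⁻ θ in Set.Ioc (-Real.pi) Real.pi, f (θ - β) =
      ∫⁻ θ in Set.Ioc (-Real.pi - β) (-Real.pi - β + 2 * Real.pi), f θ := by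
    rw [← lintegral_indicator measurableSet_Ioc, ← lintegral_indicator measurableSet_Ioc,
      ← lintegral_add_right_eq_self _ β]
    refine lintegral_congr fun θ => ?_
    simp only [Set.indicator_apply, Set.mem_Ioc, add_sub_cancel_right]
    refine if_congr ⟨fun h => ⟨by linarith [h.1], by linarith [h.2]⟩,
      fun h => ⟨by linarith [h.1], by linarith [h.2]⟩⟩ rfl rfl
  have e2 : Set.Ioc (-Real.pi) Real.pi = Set.Ioc (-Real.pi) (-Real.pi + 2 * Real.pi) := by
    congr 1; ring
  rw [e1, e2]
  refine (isAddFundamentalDomain_Ioc h2 _).setLIntegral_eq (isAddFundamentalDomain_Ioc h2 _) f ?_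
  rintro ⟨g, hg⟩ x
  obtain ⟨n, rfl⟩ := AddSubgroup.mem_zmultiples_iff.1 hg
  change f (n • (2 * Real.pi) + x) = f x
  rw [add_comm]
  exact hf.zsmul n x

/-- The integral of `|sin (θ / 2)| ^ (-1/2)` over a period. -/
def sinConst : ℝ≥0∞ := ∫⁻ θ in Set.Ioc (-Real.pi) Real.pi, ‖Real.sin (θ / 2)‖ₑ ^ (-(1 / 2) : ℝ)

theorem sinConst_lt_top : sinConst < ⊤ := by
  have hpi := Real.pi_pos
  have hle : sinConst ≤ ∫⁻ θ in Set.Icc (-Real.pi) Real.pi,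
      ‖1 / Real.pi‖ₑ ^ (-(1 / 2) : ℝ) * ‖θ‖ₑ ^ (-(1 / 2) : ℝ) := by
    refine (lintegral_mono_set Set.Ioc_subset_Icc_self).trans ?_
    refine setLIntegral_mono' measurableSet_Icc fun θ hθ => ?_
    rw [← ENNReal.mul_rpow_of_ne_top enorm_ne_top enorm_ne_top, ← enorm_mul]
    refine ENNReal.rpow_le_rpow_of_exponent_nonpos (by norm_num) ?_
    have h := Real.mul_abs_le_abs_sin (x := θ / 2)
      (by rw [abs_div, abs_two]; have := abs_le.2 hθ; linarith)
    refine enorm_le_iff_norm_le.2 ?_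
    rw [Real.norm_eq_abs, Real.norm_eq_abs]
    refine le_trans (le_of_eq ?_) h
    rw [abs_mul, abs_div, abs_div, abs_two, abs_one, abs_of_pos hpi]
    ring
  refine hle.trans_lt ?_
  have hne : ‖1 / Real.pi‖ₑ ≠ 0 := by
    rw [ne_eq, enorm_eq_zero]; positivity
  rw [lintegral_const_mul' _ _ (ENNReal.rpow_ne_top_of_ne_zero hne enorm_ne_top)]
  refine ENNReal.mul_lt_top (ENNReal.rpow_ne_top_of_ne_zero hne enorm_ne_top).lt_top ?_
  exact lintegral_Icc_enorm_rpow_neg_lt_top _ (by norm_num)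

theorem lintegral_sin_sub (β : ℝ) :
    ∫⁻ θ in Set.Ioc (-Real.pi) Real.pi, ‖Real.sin ((θ - β) / 2)‖ₑ ^ (-(1 / 2) : ℝ) =
      sinConst := by
  refine lintegral_period_comp_sub (f := fun θ => ‖Real.sin (θ / 2)‖ₑ ^ (-(1 / 2) : ℝ))
    (fun θ => ?_) β
  have : (θ + 2 * Real.pi) / 2 = θ / 2 + Real.pi := by ring
  simp only [this, Real.sin_add_pi, enorm_neg]

/-- Of two singular factors, only the one with the smaller base is really singular: the larger base
is at least `S / 2`. -/
theorem mul_rpow_neg_half_le {X Y S : ℝ≥0∞} (hX : X ≠ ⊤) (hY : Y ≠ ⊤) (hS : S ≤ X + Y) :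
    (2 * X * Y) ^ (-(1 / 2) : ℝ) ≤
      S ^ (-(1 / 2) : ℝ) * (X ^ (-(1 / 2) : ℝ) + Y ^ (-(1 / 2) : ℝ)) := by
  wlog h : X ≤ Y generalizing X Y
  · have := this hY hX (by rwa [add_comm]) (le_of_not_ge h)
    rwa [mul_right_comm, add_comm (X ^ _)]
  have h2 : (2 * X * Y) ^ (-(1 / 2) : ℝ) = (2 * Y) ^ (-(1 / 2) : ℝ) * X ^ (-(1 / 2) : ℝ) := by
    rw [← ENNReal.mul_rpow_of_ne_top (ENNReal.mul_ne_top (by simp) hY) hX, mul_right_comm]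
  rw [h2]
  refine mul_le_mul' (ENNReal.rpow_le_rpow_of_exponent_nonpos (by norm_num) ?_) le_self_add
  calc S ≤ X + Y := hS
    _ ≤ Y + Y := by gcongr
    _ = 2 * Y := (two_mul Y).symm

theorem enorm_sq_rpow_neg_quarter (x : ℝ) :
    ‖x ^ 2‖ₑ ^ (-(1 / 4) : ℝ) = ‖x‖ₑ ^ (-(1 / 2) : ℝ) := by
  rw [enorm_pow, ← ENNReal.rpow_natCast, ← ENNReal.rpow_mul]
  norm_num

/-- For `c = cos a`, factor `cos θ - cos a` into sines and use
`|sin a| ≤ |sin ((θ + a) / 2)| + |sin ((θ - a) / 2)|`. -/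
theorem lintegral_cos_sub_cos_le (a : ℝ) :
    ∫⁻ θ in Set.Ioc (-Real.pi) Real.pi, ‖Real.cos θ - Real.cos a‖ₑ ^ (-(1 / 2) : ℝ) ≤
      2 * sinConst * ‖1 - Real.cos a ^ 2‖ₑ ^ (-(1 / 4) : ℝ) := by
  have hpt : ∀ θ : ℝ, ‖Real.cos θ - Real.cos a‖ₑ ^ (-(1 / 2) : ℝ) ≤
      ‖Real.sin a‖ₑ ^ (-(1 / 2) : ℝ) * (‖Real.sin ((θ - -a) / 2)‖ₑ ^ (-(1 / 2) : ℝ) +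
        ‖Real.sin ((θ - a) / 2)‖ₑ ^ (-(1 / 2) : ℝ)) := by
    intro θ
    have e : ‖Real.cos θ - Real.cos a‖ₑ =
        2 * ‖Real.sin ((θ - -a) / 2)‖ₑ * ‖Real.sin ((θ - a) / 2)‖ₑ := by
      rw [Real.cos_sub_cos, enorm_mul, enorm_mul, enorm_neg, sub_neg_eq_add]
      congr 2
      rw [Real.enorm_eq_ofReal_abs, abs_two]; simp
    rw [e]
    refine mul_rpow_neg_half_le enorm_ne_top enorm_ne_top ?_
    have hsin : Real.sin a = Real.sin ((θ - -a) / 2) * Real.cos ((θ - a) / 2) -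
        Real.cos ((θ - -a) / 2) * Real.sin ((θ - a) / 2) := by
      rw [← Real.sin_sub]; congr 1; ring
    have hcos : ∀ u : ℝ, ‖Real.cos u‖ₑ ≤ 1 := fun u => by
      rw [Real.enorm_eq_ofReal_abs]
      exact ENNReal.ofReal_le_one.2 (Real.abs_cos_le_one u)
    rw [hsin]
    refine enorm_sub_le.trans ?_
    rw [enorm_mul, enorm_mul]
    exact add_le_add (mul_le_of_le_one_right' (hcos _)) (mul_le_of_le_one_left' (hcos _))
  have hm : Measurable fun θ : ℝ => ‖Real.sin ((θ - -a) / 2)‖ₑ ^ (-(1 / 2) : ℝ) := by fun_prop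
  have hm' : Measurable fun θ : ℝ => ‖Real.sin ((θ - -a) / 2)‖ₑ ^ (-(1 / 2) : ℝ) +
        ‖Real.sin ((θ - a) / 2)‖ₑ ^ (-(1 / 2) : ℝ) := by fun_prop
  refine (lintegral_mono hpt).trans (le_of_eq ?_)
  rw [lintegral_const_mul _ hm', lintegral_add_left hm, lintegral_sin_sub, lintegral_sin_sub,
    ← Real.sin_sq, enorm_sq_rpow_neg_quarter]
  ring

/-- For `|c| ≤ 1` this is `lintegral_cos_sub_cos_le`. For `|c| > 1`, up to a translation of `θ` by
`π`, it follows from `|cos θ - c|² ≥ |1 - c²| sin² (θ / 2)`. -/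
theorem lintegral_cos_sub_le (c : ℝ) :
    ∫⁻ θ in Set.Ioc (-Real.pi) Real.pi, ‖Real.cos θ - c‖ₑ ^ (-(1 / 2) : ℝ) ≤
      2 * sinConst * ‖1 - c ^ 2‖ₑ ^ (-(1 / 4) : ℝ) := by
  by_cases hc : c ∈ Set.Icc (-1) 1
  · have := lintegral_cos_sub_cos_le (Real.arccos c)
    rwa [Real.cos_arccos hc.1 hc.2] at this
  have key : ∃ β : ℝ, ∀ θ : ℝ, ‖Real.cos θ - c‖ₑ ^ (-(1 / 2) : ℝ) ≤
      ‖1 - c ^ 2‖ₑ ^ (-(1 / 4) : ℝ) * ‖Real.sin ((θ - β) / 2)‖ₑ ^ (-(1 / 2) : ℝ) := by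
    have hle : ∀ θ s : ℝ, |(1 - c ^ 2) * s ^ 2| ≤ (Real.cos θ - c) ^ 2 →
        ‖Real.cos θ - c‖ₑ ^ (-(1 / 2) : ℝ) ≤
          ‖1 - c ^ 2‖ₑ ^ (-(1 / 4) : ℝ) * ‖s‖ₑ ^ (-(1 / 2) : ℝ) := by
      intro θ s h
      rw [← enorm_sq_rpow_neg_quarter, ← enorm_sq_rpow_neg_quarter,
        ← ENNReal.mul_rpow_of_ne_top enorm_ne_top enorm_ne_top, ← enorm_mul]
      refine ENNReal.rpow_le_rpow_of_exponent_nonpos (by norm_num) (enorm_le_iff_norm_le.2 ?_)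
      rwa [Real.norm_eq_abs, Real.norm_of_nonneg (sq_nonneg _)]
    -- Here `d = |c| - 1`, so that `d (d + 2) = c² - 1`, and `w = sin² ((θ - β) / 2)`.
    have halg : ∀ d w : ℝ, 0 ≤ d → 0 ≤ w → w ≤ 1 → d * (d + 2) * w ≤ (d + 2 * w) ^ 2 := by
      intro d w hd hw hw1
      nlinarith [mul_nonneg (sq_nonneg d) (sub_nonneg.2 hw1), mul_nonneg hd hw, sq_nonneg w]
    rw [Set.mem_Icc, not_and_or, not_le, not_le] at hc
    rcases hc with hc | hc
    · refine ⟨Real.pi, fun θ => hle θ _ ?_⟩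
      have e : Real.cos θ = 2 * Real.sin ((θ - Real.pi) / 2) ^ 2 - 1 := by
        have h1 := Real.cos_two_mul ((θ - Real.pi) / 2)
        have h2 := Real.sin_sq ((θ - Real.pi) / 2)
        rw [mul_div_cancel₀ _ two_ne_zero, Real.cos_sub_pi] at h1
        linarith
      have hs1 := Real.sin_sq_le_one ((θ - Real.pi) / 2)
      have := halg (-1 - c) _ (by linarith) (sq_nonneg (Real.sin ((θ - Real.pi) / 2))) hs1
      rw [e, abs_of_nonpos (mul_nonpos_of_nonpos_of_nonneg (by nlinarith) (sq_nonneg _))]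
      linarith
    · refine ⟨0, fun θ => hle θ _ ?_⟩
      have e : Real.cos θ = 1 - 2 * Real.sin ((θ - 0) / 2) ^ 2 := by
        have h1 := Real.cos_two_mul ((θ - 0) / 2)
        have h2 := Real.sin_sq ((θ - 0) / 2)
        rw [mul_div_cancel₀ _ two_ne_zero, sub_zero] at h1
        rw [sub_zero] at h2 ⊢
        linarith
      have hs1 := Real.sin_sq_le_one ((θ - 0) / 2)
      have := halg (c - 1) _ (by linarith) (sq_nonneg (Real.sin ((θ - 0) / 2))) hs1
      rw [e, abs_of_nonpos (mul_nonpos_of_nonpos_of_nonneg (by nlinarith) (sq_nonneg _))]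
      linarith
  obtain ⟨β, hβ⟩ := key
  have hm : Measurable fun θ : ℝ => ‖Real.sin ((θ - β) / 2)‖ₑ ^ (-(1 / 2) : ℝ) := by fun_prop
  calc _ ≤ _ := lintegral_mono hβ
    _ = sinConst * ‖1 - c ^ 2‖ₑ ^ (-(1 / 4) : ℝ) := by
      rw [lintegral_const_mul _ hm, lintegral_sin_sub, mul_comm]
    _ ≤ _ := by
      gcongr
      rw [two_mul]; exact le_self_add

/-! ### The integral of the kernel -/

/-- A constant dominating the smoothing of `|·| ^ (-1/4)` by a Gaussian. -/
def gaussPowConst : ℝ≥0∞ :=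
  1 + (2 * (∫⁻ v : ℝ, ENNReal.ofReal (Real.exp (-v ^ 2 / 2))) +
    ∫⁻ u in Set.Icc (-1 : ℝ) 1, ‖u‖ₑ ^ (-(1 / 4) : ℝ))

theorem gaussPowConst_lt_top : gaussPowConst < ⊤ := by
  have h1 : ∫⁻ v : ℝ, ENNReal.ofReal (Real.exp (-v ^ 2 / 2)) < ⊤ := by
    have h := (integrable_exp_neg_mul_sq (b := 1 / 2) (by norm_num)).lintegral_lt_top
    have e : ∀ v : ℝ, -v ^ 2 / 2 = -(1 / 2) * v ^ 2 := fun v => by ring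
    simpa only [e] using h
  exact ENNReal.add_lt_top.2 ⟨ENNReal.one_lt_top, ENNReal.add_lt_top.2
    ⟨ENNReal.mul_lt_top (by simp) h1, lintegral_Icc_enorm_rpow_neg_lt_top 1 (by norm_num)⟩⟩

theorem exp_neg_sq_mul_abs_rpow_le (v : ℝ) :
    Real.exp (-v ^ 2) * |v| ^ (1 / 4 : ℝ) ≤ Real.exp (-v ^ 2 / 2) := by
  have h : |v| ^ (1 / 4 : ℝ) ≤ Real.exp (v ^ 2 / 2) := by
    have h2 : v ^ 2 / 2 + 1 ≤ Real.exp (v ^ 2 / 2) := Real.add_one_le_exp _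
    rcases le_total |v| 1 with h1 | h1
    · have := Real.rpow_le_one (abs_nonneg v) h1 (by norm_num : (0:ℝ) ≤ 1 / 4)
      nlinarith [sq_nonneg v]
    · have h3 : |v| ^ (1 / 4 : ℝ) ≤ |v| ^ (1 : ℝ) :=
        Real.rpow_le_rpow_of_exponent_le h1 (by norm_num)
      rw [Real.rpow_one] at h3
      nlinarith [sq_nonneg (|v| - 1), sq_abs v]
  calc _ ≤ Real.exp (-v ^ 2) * Real.exp (v ^ 2 / 2) := by gcongr
    _ = _ := by rw [← Real.exp_add]; congr 1; ring

/-- Convolution of `|·| ^ (-1/4)` with a Gaussian of fixed width does not destroy the decay: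
this follows from `|D| ^ (1/4) ≤ |v - D| ^ (1/4) + |v| ^ (1/4)`. -/
theorem lintegral_gauss_mul_rpow_le (D : ℝ) :
    ∫⁻ v : ℝ, ENNReal.ofReal (Real.exp (-v ^ 2)) * ‖v - D‖ₑ ^ (-(1 / 4) : ℝ) ≤
      gaussPowConst * ‖D‖ₑ ^ (-(1 / 4) : ℝ) := by
  rcases eq_or_ne D 0 with rfl | hD
  · rw [enorm_zero, ENNReal.zero_rpow_of_neg (by norm_num), ENNReal.mul_top]
    · exact le_top
    · simp [gaussPowConst]
  set J : ℝ → ℝ≥0∞ := (Set.Icc (-1 : ℝ) 1).indicator fun u => ‖u‖ₑ ^ (-(1 / 4) : ℝ) with hJ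
  have hJm : Measurable J := Measurable.indicator (by fun_prop) measurableSet_Icc
  have hd0 : ‖D‖ₑ ≠ 0 := by simpa using hD
  have hpow : ∀ x : ℝ, ‖x‖ₑ ^ (-(1 / 4) : ℝ) ≤ 1 + J x := by
    intro x
    by_cases hx : x ∈ Set.Icc (-1 : ℝ) 1
    · rw [hJ, Set.indicator_of_mem hx]; exact le_add_self
    · refine le_trans ?_ le_self_add
      refine ENNReal.rpow_le_one_of_one_le_of_neg ?_ (by norm_num)
      rw [Real.enorm_eq_ofReal_abs, ENNReal.one_le_ofReal]
      by_contra h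
      exact hx (abs_le.1 (not_le.1 h).le)
  have hpt : ∀ v : ℝ, ENNReal.ofReal (Real.exp (-v ^ 2)) * ‖v - D‖ₑ ^ (-(1 / 4) : ℝ) ≤
      ‖D‖ₑ ^ (-(1 / 4) : ℝ) * (2 * ENNReal.ofReal (Real.exp (-v ^ 2 / 2)) + J (v - D)) := by
    intro v
    set E := ENNReal.ofReal (Real.exp (-v ^ 2))
    set E' := ENNReal.ofReal (Real.exp (-v ^ 2 / 2))
    set X := ‖v - D‖ₑ
    have hE'1 : E' ≤ 1 := ENNReal.ofReal_le_one.2 (Real.exp_le_one_iff.2 (by nlinarith [sq_nonneg v]))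
    have hE : E ≤ E' := ENNReal.ofReal_le_ofReal (Real.exp_le_exp.2 (by nlinarith [sq_nonneg v]))
    have hEV : E * ‖v‖ₑ ^ (1 / 4 : ℝ) ≤ E' := by
      rw [Real.enorm_eq_ofReal_abs, ENNReal.ofReal_rpow_of_nonneg (abs_nonneg v) (by norm_num),
        ← ENNReal.ofReal_mul (Real.exp_pos _).le]
      exact ENNReal.ofReal_le_ofReal (exp_neg_sq_mul_abs_rpow_le v)
    have hXX : X ^ (1 / 4 : ℝ) * X ^ (-(1 / 4) : ℝ) ≤ 1 := by
      rw [ENNReal.rpow_neg]; exact ENNReal.mul_inv_le_one _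
    have hdX : ‖D‖ₑ ^ (1 / 4 : ℝ) ≤ X ^ (1 / 4 : ℝ) + ‖v‖ₑ ^ (1 / 4 : ℝ) := by
      refine le_trans (ENNReal.rpow_le_rpow ?_ (by norm_num))
        (ENNReal.rpow_add_le_add_rpow _ _ (by norm_num) (by norm_num))
      have : D = v - (v - D) := by ring
      rw [add_comm]
      exact (congrArg _ this).trans_le enorm_sub_le
    have hone : ‖D‖ₑ ^ (-(1 / 4) : ℝ) * ‖D‖ₑ ^ (1 / 4 : ℝ) = 1 := by
      rw [← ENNReal.rpow_add _ _ hd0 enorm_ne_top]; norm_num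
    calc E * X ^ (-(1 / 4) : ℝ)
        = ‖D‖ₑ ^ (-(1 / 4) : ℝ) * (‖D‖ₑ ^ (1 / 4 : ℝ) * (E * X ^ (-(1 / 4) : ℝ))) := by
          rw [← mul_assoc (‖D‖ₑ ^ (-(1 / 4) : ℝ)), hone, one_mul]
      _ ≤ ‖D‖ₑ ^ (-(1 / 4) : ℝ) *
          ((X ^ (1 / 4 : ℝ) + ‖v‖ₑ ^ (1 / 4 : ℝ)) * (E * X ^ (-(1 / 4) : ℝ))) := by gcongr
      _ = ‖D‖ₑ ^ (-(1 / 4) : ℝ) * (E * (X ^ (1 / 4 : ℝ) * X ^ (-(1 / 4) : ℝ)) +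
          E * ‖v‖ₑ ^ (1 / 4 : ℝ) * X ^ (-(1 / 4) : ℝ)) := by ring
      _ ≤ ‖D‖ₑ ^ (-(1 / 4) : ℝ) * (E' * 1 + E' * (1 + J (v - D))) := by
          gcongr
          exact hpow _
      _ = ‖D‖ₑ ^ (-(1 / 4) : ℝ) * (2 * E' + E' * J (v - D)) := by ring
      _ ≤ _ := by
          gcongr
          exact mul_le_of_le_one_left' hE'1
  calc _ ≤ _ := lintegral_mono hpt
    _ = ‖D‖ₑ ^ (-(1 / 4) : ℝ) * (2 * (∫⁻ v : ℝ, ENNReal.ofReal (Real.exp (-v ^ 2 / 2))) +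
        ∫⁻ u in Set.Icc (-1 : ℝ) 1, ‖u‖ₑ ^ (-(1 / 4) : ℝ)) := by
      have hm1 : Measurable fun v : ℝ => 2 * ENNReal.ofReal (Real.exp (-v ^ 2 / 2)) := by fun_prop
      have hm12 : Measurable fun v : ℝ =>
          2 * ENNReal.ofReal (Real.exp (-v ^ 2 / 2)) + J (v - D) :=
        hm1.add (hJm.comp (measurable_id.sub_const D))
      have hm3 : Measurable fun v : ℝ => ENNReal.ofReal (Real.exp (-v ^ 2 / 2)) := by fun_prop
      rw [lintegral_const_mul _ hm12, lintegral_add_left hm1, lintegral_const_mul _ hm3,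
        lintegral_sub_right_eq_self J D, hJ, lintegral_indicator measurableSet_Icc]
    _ ≤ _ := by
      rw [mul_comm, gaussPowConst]
      exact mul_le_mul' le_add_self le_rfl

/-- A change of variables `v = (lam / 2) (r² - q)`. -/
theorem lintegral_Ioi_mul_comp_sq_le {lam : ℝ} (hl : 0 < lam) (q : ℝ) (g : ℝ → ℝ≥0∞) :
    ∫⁻ r in Set.Ioi (0 : ℝ), ENNReal.ofReal (lam * r) * g (lam * (r ^ 2 - q) / 2) ≤
      ∫⁻ v, g v := by
  have hder : ∀ r ∈ Set.Ioi (0 : ℝ), HasDerivWithinAt (fun r => lam * (r ^ 2 - q) / 2) (lam * r)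
      (Set.Ioi 0) r := by
    intro r _
    have h := (((hasDerivAt_pow 2 r).sub_const q).const_mul lam).div_const 2
    refine (h.congr_deriv ?_).hasDerivWithinAt
    simp; ring
  have hinj : Set.InjOn (fun r => lam * (r ^ 2 - q) / 2) (Set.Ioi 0) := by
    intro r hr s hs h
    have h1 : r ^ 2 = s ^ 2 := by
      have h2 : lam * (r ^ 2 - s ^ 2) = 0 := by simp only at h; linarith
      rcases mul_eq_zero.1 h2 with h3 | h3 <;> linarith
    exact (pow_left_inj₀ (le_of_lt hr) (le_of_lt hs) two_ne_zero).1 h1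
  have h := lintegral_image_eq_lintegral_abs_deriv_mul measurableSet_Ioi hder hinj g
  have e : ∫⁻ r in Set.Ioi (0 : ℝ), ENNReal.ofReal (lam * r) * g (lam * (r ^ 2 - q) / 2) =
      ∫⁻ r in Set.Ioi (0 : ℝ), ENNReal.ofReal |lam * r| * g (lam * (r ^ 2 - q) / 2) := by
    refine setLIntegral_congr_fun measurableSet_Ioi fun r hr => ?_
    simp only [abs_of_pos (mul_pos hl hr)]
  rw [e, ← h]
  exact setLIntegral_le_lintegral _ _

/-- A majorant of the kernel obtained by squaring out the weighted `L²` norm of the square of the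
parabolic extension; `a` and `b` are pairs of frequencies. -/
def oscKernel (lam : ℝ) (a b : ℝ × ℝ) : ℝ≥0∞ :=
  4 * (‖lam * ((a.1 + a.2) - (b.1 + b.2))‖ₑ ^ (-(1 / 2) : ℝ) *
    ENNReal.ofReal (Real.exp (-(lam * ((a.1 ^ 2 + a.2 ^ 2) - (b.1 ^ 2 + b.2 ^ 2))) ^ 2 / 4)))

theorem measurable_oscKernel (lam : ℝ) : Measurable (Function.uncurry (oscKernel lam)) := by
  unfold Function.uncurry oscKernel
  fun_prop

theorem measurable_oscKernel_right (lam : ℝ) (a : ℝ × ℝ) : Measurable (oscKernel lam a) := by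
  unfold oscKernel
  fun_prop

theorem oscKernel_symm (lam : ℝ) (a b : ℝ × ℝ) : oscKernel lam a b = oscKernel lam b a := by
  have h1 : lam * ((a.1 + a.2) - (b.1 + b.2)) = -(lam * ((b.1 + b.2) - (a.1 + a.2))) := by ring
  have h2 : (lam * ((a.1 ^ 2 + a.2 ^ 2) - (b.1 ^ 2 + b.2 ^ 2))) ^ 2 =
      (lam * ((b.1 ^ 2 + b.2 ^ 2) - (a.1 ^ 2 + a.2 ^ 2))) ^ 2 := by ring
  rw [oscKernel, oscKernel, h1, enorm_neg, h2]

theorem lintegral_eq_lintegral_polar {f : ℝ × ℝ → ℝ≥0∞} (hf : Measurable f) :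
    ∫⁻ b, f b = ∫⁻ r in Set.Ioi (0 : ℝ), ENNReal.ofReal r *
      ∫⁻ θ in Set.Ioo (-Real.pi) Real.pi, f (r * Real.cos θ, r * Real.sin θ) := by
  have hm : Measurable fun p : ℝ × ℝ =>
      ENNReal.ofReal p.1 * f (p.1 * Real.cos p.2, p.1 * Real.sin p.2) := by
    refine (by fun_prop : Measurable fun p : ℝ × ℝ => ENNReal.ofReal p.1).mul (hf.comp ?_)
    fun_prop
  have hm' : ∀ r : ℝ, Measurable fun θ : ℝ => f (r * Real.cos θ, r * Real.sin θ) := fun r =>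
    hf.comp (by fun_prop)
  rw [← lintegral_comp_polarCoord_symm, polarCoord_target, Measure.volume_eq_prod,
    ← Measure.prod_restrict]
  simp only [polarCoord_symm_apply, smul_eq_mul]
  rw [lintegral_prod _ hm.aemeasurable]
  refine lintegral_congr fun r => ?_
  exact lintegral_const_mul (ENNReal.ofReal r) (hm' r)

/-- The angular integral of the kernel: with `b` on the circle of radius `r`, the sum of its
coordinates is `√2 r cos (θ - π / 4)`. The result is written in the variable
`v = lam (r² - |a|²) / 2`, in which the Gaussian factor is `e^{-v²}`. -/
theorem lintegral_oscKernel_angle_le {lam : ℝ} (hl : 0 < lam) (a : ℝ × ℝ) {r : ℝ} (hr : 0 < r) :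
    ∫⁻ θ in Set.Ioo (-Real.pi) Real.pi, oscKernel lam a (r * Real.cos θ, r * Real.sin θ) ≤
      8 * sinConst * ‖4 * lam‖ₑ ^ (-(1 / 4) : ℝ) *
        (ENNReal.ofReal (Real.exp (-(lam * (r ^ 2 - (a.1 ^ 2 + a.2 ^ 2)) / 2) ^ 2)) *
        ‖lam * (r ^ 2 - (a.1 ^ 2 + a.2 ^ 2)) / 2 - -(lam * (a.1 - a.2) ^ 2 / 4)‖ₑ ^
          (-(1 / 4) : ℝ)) := by
  have h2 : (0 : ℝ) < Real.sqrt 2 := by positivity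
  have h22 : Real.sqrt 2 ^ 2 = 2 := Real.sq_sqrt (by norm_num)
  set E := ENNReal.ofReal (Real.exp (-(lam * (r ^ 2 - (a.1 ^ 2 + a.2 ^ 2)) / 2) ^ 2)) with hE
  set c := (a.1 + a.2) / (Real.sqrt 2 * r) with hc
  have hpt : ∀ θ : ℝ, oscKernel lam a (r * Real.cos θ, r * Real.sin θ) =
      4 * E * ‖lam * (Real.sqrt 2 * r)‖ₑ ^ (-(1 / 2) : ℝ) *
        ‖Real.cos (θ - Real.pi / 4) - c‖ₑ ^ (-(1 / 2) : ℝ) := by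
    intro θ
    have e1 : lam * ((a.1 + a.2) - (r * Real.cos θ + r * Real.sin θ)) =
        -(lam * (Real.sqrt 2 * r) * (Real.cos (θ - Real.pi / 4) - c)) := by
      rw [Real.cos_sub, Real.cos_pi_div_four, Real.sin_pi_div_four, hc]
      field_simp
      linear_combination ((Real.cos θ + Real.sin θ) * r) * h22
    have e2 : -(lam * ((a.1 ^ 2 + a.2 ^ 2) - ((r * Real.cos θ) ^ 2 + (r * Real.sin θ) ^ 2))) ^ 2 / 4
        = -(lam * (r ^ 2 - (a.1 ^ 2 + a.2 ^ 2)) / 2) ^ 2 := by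
      have : (r * Real.cos θ) ^ 2 + (r * Real.sin θ) ^ 2 = r ^ 2 := by
        linear_combination r ^ 2 * Real.sin_sq_add_cos_sq θ
      rw [this]; ring
    rw [oscKernel]
    simp only
    rw [e1, e2, enorm_neg, enorm_mul, ENNReal.mul_rpow_of_ne_top enorm_ne_top enorm_ne_top]
    ring
  have hmc : Measurable fun θ : ℝ => ‖Real.cos (θ - Real.pi / 4) - c‖ₑ ^ (-(1 / 2) : ℝ) := by
    fun_prop
  calc _ ≤ ∫⁻ θ in Set.Ioc (-Real.pi) Real.pi,
        4 * E * ‖lam * (Real.sqrt 2 * r)‖ₑ ^ (-(1 / 2) : ℝ) *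
        ‖Real.cos (θ - Real.pi / 4) - c‖ₑ ^ (-(1 / 2) : ℝ) := by
        simp only [hpt]
        exact lintegral_mono_set Set.Ioo_subset_Ioc_self
    _ = 4 * E * ‖lam * (Real.sqrt 2 * r)‖ₑ ^ (-(1 / 2) : ℝ) *
        ∫⁻ θ in Set.Ioc (-Real.pi) Real.pi, ‖Real.cos θ - c‖ₑ ^ (-(1 / 2) : ℝ) := by
        rw [lintegral_const_mul _ hmc, lintegral_period_comp_sub
          (f := fun θ => ‖Real.cos θ - c‖ₑ ^ (-(1 / 2) : ℝ))]
        intro θ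
        simp only [Real.cos_add_two_pi]
    _ ≤ 4 * E * ‖lam * (Real.sqrt 2 * r)‖ₑ ^ (-(1 / 2) : ℝ) *
        (2 * sinConst * ‖1 - c ^ 2‖ₑ ^ (-(1 / 4) : ℝ)) := by
        gcongr
        exact lintegral_cos_sub_le c
    _ = 8 * sinConst * E * (‖lam * (Real.sqrt 2 * r)‖ₑ ^ (-(1 / 2) : ℝ) *
        ‖1 - c ^ 2‖ₑ ^ (-(1 / 4) : ℝ)) := by ring
    _ = 8 * sinConst * E * ‖(4 * lam) * (lam * (r ^ 2 - (a.1 ^ 2 + a.2 ^ 2)) / 2 -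
          -(lam * (a.1 - a.2) ^ 2 / 4))‖ₑ ^ (-(1 / 4) : ℝ) := by
        rw [← enorm_sq_rpow_neg_quarter, ← ENNReal.mul_rpow_of_ne_top enorm_ne_top enorm_ne_top,
          ← enorm_mul]
        congr 3
        -- `2 (r² - |a|²) + (a.1 - a.2)² = 2 r² - (a.1 + a.2)²`
        rw [hc]
        field_simp
        rw [h22]
        ring
    _ = _ := by
        rw [enorm_mul, ENNReal.mul_rpow_of_ne_top enorm_ne_top enorm_ne_top]
        ring

/-- The bound for the integral of the kernel required by Schur's test. The singularity on the
diagonal `a.1 = a.2` comes from the points of the circle where `a.1 + a.2` is stationary. -/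
theorem lintegral_oscKernel_le {lam : ℝ} (hl : 0 < lam) (a : ℝ × ℝ) :
    ∫⁻ b, oscKernel lam a b ≤ 8 * sinConst * gaussPowConst *
      ENNReal.ofReal (lam ^ (-(3 / 2) : ℝ)) * ‖a.1 - a.2‖ₑ ^ (-(1 / 2) : ℝ) := by
  set q := a.1 ^ 2 + a.2 ^ 2 with hq
  set D := -(lam * (a.1 - a.2) ^ 2 / 4) with hD
  set g : ℝ → ℝ≥0∞ := fun v => ENNReal.ofReal (Real.exp (-v ^ 2)) * ‖v - D‖ₑ ^ (-(1 / 4) : ℝ)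
    with hg
  set K := 8 * sinConst * ‖4 * lam‖ₑ ^ (-(1 / 4) : ℝ) with hK
  have hgm : Measurable g := by simp only [hg]; fun_prop
  have hkm : Measurable (oscKernel lam a) := measurable_oscKernel_right lam a
  have hl1 : ENNReal.ofReal lam⁻¹ * ENNReal.ofReal lam = 1 := by
    rw [← ENNReal.ofReal_mul (by positivity), inv_mul_cancel₀ hl.ne', ENNReal.ofReal_one]
  calc ∫⁻ b, oscKernel lam a b
      = ∫⁻ r in Set.Ioi (0 : ℝ), ENNReal.ofReal r *
        ∫⁻ θ in Set.Ioo (-Real.pi) Real.pi, oscKernel lam a (r * Real.cos θ, r * Real.sin θ) :=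
        by rw [lintegral_eq_lintegral_polar hkm]
    _ ≤ ∫⁻ r in Set.Ioi (0 : ℝ), K * ENNReal.ofReal lam⁻¹ *
        (ENNReal.ofReal (lam * r) * g (lam * (r ^ 2 - q) / 2)) := by
        refine setLIntegral_mono' measurableSet_Ioi fun r hr => ?_
        have hang : ∫⁻ θ in Set.Ioo (-Real.pi) Real.pi,
            oscKernel lam a (r * Real.cos θ, r * Real.sin θ) ≤ K * g (lam * (r ^ 2 - q) / 2) :=
          lintegral_oscKernel_angle_le hl a hr
        refine (mul_le_mul' le_rfl hang).trans (le_of_eq ?_)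
        rw [ENNReal.ofReal_mul hl.le]
        clear_value K g
        calc ENNReal.ofReal r * (K * g (lam * (r ^ 2 - q) / 2))
            = (ENNReal.ofReal lam⁻¹ * ENNReal.ofReal lam) *
              (ENNReal.ofReal r * (K * g (lam * (r ^ 2 - q) / 2))) := by rw [hl1, one_mul]
          _ = _ := by ring
    _ = K * ENNReal.ofReal lam⁻¹ * ∫⁻ r in Set.Ioi (0 : ℝ),
        (ENNReal.ofReal (lam * r) * g (lam * (r ^ 2 - q) / 2)) := by
        refine lintegral_const_mul (K * ENNReal.ofReal lam⁻¹) ?_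
        exact (by fun_prop : Measurable fun r : ℝ => ENNReal.ofReal (lam * r)).mul
          (hgm.comp (by fun_prop))
    _ ≤ K * ENNReal.ofReal lam⁻¹ * (gaussPowConst * ‖D‖ₑ ^ (-(1 / 4) : ℝ)) := by
        gcongr
        exact (lintegral_Ioi_mul_comp_sq_le hl q g).trans (lintegral_gauss_mul_rpow_le D)
    _ = 8 * sinConst * gaussPowConst * (ENNReal.ofReal lam⁻¹ *
        (‖4 * lam‖ₑ ^ (-(1 / 4) : ℝ) * ‖D‖ₑ ^ (-(1 / 4) : ℝ))) := by rw [hK]; ring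
    _ = 8 * sinConst * gaussPowConst * (ENNReal.ofReal lam⁻¹ *
        (‖lam‖ₑ ^ (-(1 / 2) : ℝ) * ‖a.1 - a.2‖ₑ ^ (-(1 / 2) : ℝ))) := by
        rw [← ENNReal.mul_rpow_of_ne_top enorm_ne_top enorm_ne_top, ← enorm_mul,
          ← ENNReal.mul_rpow_of_ne_top enorm_ne_top enorm_ne_top, ← enorm_mul,
          ← enorm_sq_rpow_neg_quarter, ← enorm_neg]
        congr 4
        rw [hD]; ring
    _ = _ := by
        have : ENNReal.ofReal lam⁻¹ * ‖lam‖ₑ ^ (-(1 / 2) : ℝ) =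
            ENNReal.ofReal (lam ^ (-(3 / 2) : ℝ)) := by
          rw [Real.enorm_eq_ofReal hl.le, ENNReal.ofReal_rpow_of_pos hl,
            ← ENNReal.ofReal_mul (by positivity), ← Real.rpow_neg_one, ← Real.rpow_add hl]
          norm_num
        rw [← mul_assoc (ENNReal.ofReal lam⁻¹), this]
        ring

/-! ### The extension estimate -/

/-- The extension operator of the parabola, in the coordinates `(x², y)` and with frequencies in
`[-R, R]`: this is `oscOp` with the sharp cutoff `|t| ≤ R` in place of a smooth one. -/
def parabExt (lam R : ℝ) (g : ℝ → ℂ) (z : ℝ × ℝ) : ℂ :=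
  ∫ t in Set.Icc (-R) R,
    Complex.exp (Complex.I * ((lam * (z.1 ^ 2 * t + z.2 * t ^ 2) : ℝ) : ℂ)) * g t

/-- The square of the extension as an oscillatory integral over pairs of frequencies. -/
theorem parabExt_sq (lam R : ℝ) (g : ℝ → ℂ) (z : ℝ × ℝ) :
    parabExt lam R g z ^ 2 =
      ∫ a : ℝ × ℝ, Complex.exp (Complex.I *
        ((lam * (z.1 ^ 2 * (a.1 + a.2) + z.2 * (a.1 ^ 2 + a.2 ^ 2)) : ℝ) : ℂ)) * (g a.1 * g a.2)
        ∂((volume.restrict (Set.Icc (-R) R)).prod (volume.restrict (Set.Icc (-R) R))) := by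
  rw [sq, parabExt, ← integral_prod_mul]
  refine integral_congr_ae (ae_of_all _ fun a => ?_)
  have e : Complex.exp (Complex.I *
        ((lam * (z.1 ^ 2 * (a.1 + a.2) + z.2 * (a.1 ^ 2 + a.2 ^ 2)) : ℝ) : ℂ)) =
      Complex.exp (Complex.I * ((lam * (z.1 ^ 2 * a.1 + z.2 * a.1 ^ 2) : ℝ) : ℂ)) *
      Complex.exp (Complex.I * ((lam * (z.1 ^ 2 * a.2 + z.2 * a.2 ^ 2) : ℝ) : ℂ)) := by
    rw [← Complex.exp_add]; congr 1; push_cast; ring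
  simp only [e]
  ring

theorem enorm_integral_phase_le_oscKernel (lam : ℝ) (a b : ℝ × ℝ) :
    ‖∫ z : ℝ × ℝ, Complex.exp (Complex.I *
        ((lam * (z.1 ^ 2 * (a.1 + a.2) + z.2 * (a.1 ^ 2 + a.2 ^ 2)) -
          lam * (z.1 ^ 2 * (b.1 + b.2) + z.2 * (b.1 ^ 2 + b.2 ^ 2)) : ℝ) : ℂ))
        ∂(gaussWeight.prod gaussWeight)‖ₑ ≤ oscKernel lam a b := by
  have e : ∀ z : ℝ × ℝ, Complex.exp (Complex.I *
        ((lam * (z.1 ^ 2 * (a.1 + a.2) + z.2 * (a.1 ^ 2 + a.2 ^ 2)) -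
          lam * (z.1 ^ 2 * (b.1 + b.2) + z.2 * (b.1 ^ 2 + b.2 ^ 2)) : ℝ) : ℂ)) =
      Complex.exp (Complex.I * ((lam * ((a.1 + a.2) - (b.1 + b.2)) * z.1 ^ 2 : ℝ) : ℂ)) *
      Complex.exp (Complex.I *
        ((lam * ((a.1 ^ 2 + a.2 ^ 2) - (b.1 ^ 2 + b.2 ^ 2)) * z.2 : ℝ) : ℂ)) := by
    intro z
    rw [← Complex.exp_add]; congr 1; push_cast; ring
  simp only [e]
  rw [integral_prod_mul
    (fun x : ℝ => Complex.exp (Complex.I * ((lam * ((a.1 + a.2) - (b.1 + b.2)) * x ^ 2 : ℝ) : ℂ)))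
    (fun y : ℝ => Complex.exp (Complex.I *
        ((lam * ((a.1 ^ 2 + a.2 ^ 2) - (b.1 ^ 2 + b.2 ^ 2)) * y : ℝ) : ℂ))), enorm_mul]
  refine (mul_le_mul' (enorm_integral_gaussWeight_sq_le _)
    (enorm_integral_gaussWeight_linear_le _)).trans (le_of_eq ?_)
  rw [oscKernel, show (4 : ℝ≥0∞) = 2 * 2 by norm_num]
  ring

/-- The constant in the `L⁴` bound for the parabolic extension with frequencies in `[-R, R]` and
Gaussian weights in space. -/
def extConst (R : ℝ) : ℝ≥0∞ :=
  32 * sinConst * gaussPowConst *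
    ∫⁻ u in Set.Icc (-(2 * R)) (2 * R), ‖u‖ₑ ^ (-(1 / 2) : ℝ)

theorem extConst_lt_top (R : ℝ) : extConst R < ⊤ :=
  ENNReal.mul_lt_top (ENNReal.mul_lt_top (ENNReal.mul_lt_top (by simp) sinConst_lt_top)
    gaussPowConst_lt_top) (lintegral_Icc_enorm_rpow_neg_lt_top _ (by norm_num))

theorem lintegral_Icc_sub_le {R t : ℝ} (ht : t ∈ Set.Icc (-R) R) :
    ∫⁻ s in Set.Icc (-R) R, ‖t - s‖ₑ ^ (-(1 / 2) : ℝ) ≤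
      ∫⁻ u in Set.Icc (-(2 * R)) (2 * R), ‖u‖ₑ ^ (-(1 / 2) : ℝ) := by
  rw [← lintegral_indicator measurableSet_Icc, ← lintegral_indicator measurableSet_Icc,
    ← lintegral_sub_left_eq_self (fun u => (Set.Icc (-(2 * R)) (2 * R)).indicator
      (fun u => ‖u‖ₑ ^ (-(1 / 2) : ℝ)) u) t]
  refine lintegral_mono fun s => ?_
  by_cases hs : s ∈ Set.Icc (-R) R
  · rw [Set.indicator_of_mem hs, Set.indicator_of_mem
      (show t - s ∈ Set.Icc (-(2 * R)) (2 * R) from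
        ⟨by linarith [ht.1, hs.2], by linarith [ht.2, hs.1]⟩)]
  · rw [Set.indicator_of_notMem hs]; exact zero_le

/-- Schur's test is used twice: for the oscillatory integral over pairs of frequencies, and for the
form `∫∫ |g(t)|² |g(s)|² |t - s| ^ (-1/2)` that results. -/
theorem lintegral_parabExt_gaussWeight_le {lam : ℝ} (hl : 0 < lam) {R : ℝ} {g : ℝ → ℂ}
    (hg : Integrable g (volume.restrict (Set.Icc (-R) R))) :
    ∫⁻ z, ‖parabExt lam R g z‖ₑ ^ 4 ∂(gaussWeight.prod gaussWeight) ≤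
      extConst R * ENNReal.ofReal (lam ^ (-(3 / 2) : ℝ)) *
        ∫⁻ t in Set.Icc (-R) R, ‖g t‖ₑ ^ 4 := by
  set ν := volume.restrict (Set.Icc (-R) R) with hν
  set L := ENNReal.ofReal (lam ^ (-(3 / 2) : ℝ)) with hL
  set W := ∫⁻ u in Set.Icc (-(2 * R)) (2 * R), ‖u‖ₑ ^ (-(1 / 2) : ℝ) with hW
  have hgm : AEMeasurable (fun t => ‖g t‖ₑ ^ 2) ν := hg.1.enorm.pow_const 2
  have hkm : Measurable (Function.uncurry fun s t : ℝ => ‖s - t‖ₑ ^ (-(1 / 2) : ℝ)) := by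
    unfold Function.uncurry; fun_prop
  have hTT := lintegral_enorm_sq_oscillatory_le (m := gaussWeight.prod gaussWeight)
    (ν := ν.prod ν)
    (P := fun z a : ℝ × ℝ => lam * (z.1 ^ 2 * (a.1 + a.2) + z.2 * (a.1 ^ 2 + a.2 ^ 2)))
    (by unfold Function.uncurry; fun_prop) (hg.mul_prod hg) (measurable_oscKernel lam)
    (oscKernel_symm lam) (enorm_integral_phase_le_oscKernel lam)
  have hker : ∀ a : ℝ × ℝ, ∫⁻ b, oscKernel lam a b ∂(ν.prod ν) ≤
      8 * sinConst * gaussPowConst * L * ‖a.1 - a.2‖ₑ ^ (-(1 / 2) : ℝ) := by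
    intro a
    refine le_trans ?_ (lintegral_oscKernel_le hl a)
    rw [hν, Measure.prod_restrict, ← Measure.volume_eq_prod]
    exact setLIntegral_le_lintegral _ _
  have hsq : ∀ z, ‖parabExt lam R g z‖ₑ ^ 4 = ‖parabExt lam R g z ^ 2‖ₑ ^ 2 := by
    intro z; rw [enorm_pow, ← pow_mul]
  calc ∫⁻ z, ‖parabExt lam R g z‖ₑ ^ 4 ∂(gaussWeight.prod gaussWeight)
      ≤ 2 * ∫⁻ a : ℝ × ℝ, ‖g a.1 * g a.2‖ₑ ^ 2 * ∫⁻ b, oscKernel lam a b ∂(ν.prod ν)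
          ∂(ν.prod ν) := by
        simp only [hsq, parabExt_sq]
        exact hTT
    _ ≤ 2 * ∫⁻ a : ℝ × ℝ, 8 * sinConst * gaussPowConst * L *
          (‖g a.1‖ₑ ^ 2 * ‖g a.2‖ₑ ^ 2 * ‖a.1 - a.2‖ₑ ^ (-(1 / 2) : ℝ)) ∂(ν.prod ν) := by
        refine mul_le_mul' le_rfl (lintegral_mono fun a => ?_)
        refine (mul_le_mul' le_rfl (hker a)).trans (le_of_eq ?_)
        rw [enorm_mul, mul_pow]
        ring
    _ = 16 * sinConst * gaussPowConst * L * ∫⁻ a : ℝ × ℝ,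
          ‖g a.1‖ₑ ^ 2 * ‖g a.2‖ₑ ^ 2 * ‖a.1 - a.2‖ₑ ^ (-(1 / 2) : ℝ) ∂(ν.prod ν) := by
        rw [lintegral_const_mul'']
        · ring
        · exact (hgm.comp_fst.mul hgm.comp_snd).mul hkm.aemeasurable
    _ ≤ 16 * sinConst * gaussPowConst * L *
          (2 * ∫⁻ s, (‖g s‖ₑ ^ 2) ^ 2 * ∫⁻ t, ‖s - t‖ₑ ^ (-(1 / 2) : ℝ) ∂ν ∂ν) := by
        gcongr
        refine lintegral_lintegral_mul_le_of_symm hgm hkm fun s t => ?_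
        rw [← enorm_neg, neg_sub]
    _ ≤ 16 * sinConst * gaussPowConst * L * (2 * ∫⁻ s, ‖g s‖ₑ ^ 4 * W ∂ν) := by
        refine mul_le_mul' le_rfl (mul_le_mul' le_rfl
          (setLIntegral_mono' measurableSet_Icc fun s hs => ?_))
        rw [← pow_mul]
        exact mul_le_mul' le_rfl (lintegral_Icc_sub_le hs)
    _ = _ := by
        rw [lintegral_mul_const'' _ (hg.1.enorm.pow_const 4), extConst]
        ring

theorem restrict_Icc_le_gaussWeight {R : ℝ} :
    (volume.restrict (Set.Icc (-R) R) : Measure ℝ) ≤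
      ENNReal.ofReal (Real.exp (R ^ 2)) • gaussWeight := by
  have h1 : ∀ x ∈ Set.Icc (-R) R,
      1 ≤ ENNReal.ofReal (Real.exp (R ^ 2)) * ENNReal.ofReal (Real.exp (-x ^ 2)) := by
    intro x hx
    rw [← ENNReal.ofReal_mul (Real.exp_pos _).le, ← Real.exp_add, ENNReal.one_le_ofReal,
      Real.one_le_exp_iff]
    nlinarith [hx.1, hx.2]
  refine Measure.le_iff.2 fun s hs => ?_
  rw [Measure.restrict_apply hs, Measure.smul_apply, gaussWeight, withDensity_apply _ hs,
    smul_eq_mul, ← lintegral_const_mul _ measurable_gaussDensity, ← setLIntegral_one]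
  refine (setLIntegral_mono' (hs.inter measurableSet_Icc) fun x hx => h1 x hx.2).trans ?_
  exact lintegral_mono_set Set.inter_subset_left

theorem setLIntegral_box_le_gaussWeight {R : ℝ} (F : ℝ × ℝ → ℝ≥0∞) :
    ∫⁻ z in Set.Icc (-R) R ×ˢ Set.Icc (-R) R, F z ≤
      ENNReal.ofReal (Real.exp (R ^ 2)) ^ 2 * ∫⁻ z, F z ∂(gaussWeight.prod gaussWeight) := by
  rw [Measure.volume_eq_prod, ← Measure.prod_restrict]
  refine (lintegral_mono' (Measure.prod_mono restrict_Icc_le_gaussWeight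
    restrict_Icc_le_gaussWeight) le_rfl).trans (le_of_eq ?_)
  rw [Measure.prod_smul_left, Measure.prod_smul_right, lintegral_smul_measure,
    lintegral_smul_measure, smul_eq_mul, smul_eq_mul, ← mul_assoc,
    sq (ENNReal.ofReal _)]

theorem setLIntegral_parabExt_le {lam : ℝ} (hl : 0 < lam) {R : ℝ} {g : ℝ → ℂ}
    (hg : Integrable g (volume.restrict (Set.Icc (-R) R))) :
    ∫⁻ z in Set.Icc (-R) R ×ˢ Set.Icc (-R) R, ‖parabExt lam R g z‖ₑ ^ 4 ≤
      ENNReal.ofReal (Real.exp (R ^ 2)) ^ 2 * extConst R *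
        ENNReal.ofReal (lam ^ (-(3 / 2) : ℝ)) * ∫⁻ t in Set.Icc (-R) R, ‖g t‖ₑ ^ 4 := by
  refine (setLIntegral_box_le_gaussWeight _).trans ?_
  rw [mul_assoc, mul_assoc, ← mul_assoc (extConst R)]
  gcongr
  exact lintegral_parabExt_gaussWeight_le hl hg

/-! ### From sharp to smooth cutoffs -/

theorem lintegral_pow_four_le {α : Type*} [MeasurableSpace α] (ν : Measure α) {h : α → ℝ≥0∞}
    (hh : AEMeasurable h ν) :
    (∫⁻ a, h a ∂ν) ^ 4 ≤ ν Set.univ ^ 3 * ∫⁻ a, h a ^ 4 ∂ν := by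
  have hpq : (4 : ℝ).HolderConjugate (4 / 3) := by
    rw [Real.holderConjugate_iff]; norm_num
  have H := ENNReal.lintegral_mul_le_Lp_mul_Lq ν hpq hh (aemeasurable_const (b := (1 : ℝ≥0∞)))
  have e4 : ∀ x : ℝ≥0∞, x ^ (4 : ℝ) = x ^ 4 := fun x => by
    rw [← ENNReal.rpow_natCast]; norm_num
  simp only [Pi.mul_apply, mul_one, ENNReal.one_rpow, lintegral_const, one_mul, e4] at H
  calc (∫⁻ a, h a ∂ν) ^ 4
      ≤ ((∫⁻ a, h a ^ 4 ∂ν) ^ (1 / (4 : ℝ)) * ν Set.univ ^ (1 / (4 / 3 : ℝ))) ^ 4 := by gcongr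
    _ = _ := by
      rw [mul_pow, ← e4, ← e4, ← ENNReal.rpow_mul, ← ENNReal.rpow_mul, mul_comm,
        ← ENNReal.rpow_natCast (ν Set.univ) 3]
      norm_num

/-- A smooth cutoff vanishing near the end of the `t`-interval is a superposition of the sharp
cutoffs `t ≤ s`, with density `-∂_t ψ`. -/
theorem cutoff_eq_neg_integral {R : ℝ} {φ : ℝ → ℂ} (hφ : ContDiff ℝ 1 φ) (hR : φ R = 0) {t : ℝ}
    (ht : t ∈ Set.Icc (-R) R) :
    φ t = -∫ s in Set.Icc (-R) R, (Set.Iic s).indicator (fun _ => deriv φ s) t := by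
  have h1 : ∀ s, (Set.Iic s).indicator (fun _ => deriv φ s) t =
      (Set.Ici t).indicator (deriv φ) s := fun s => by
    simp only [Set.indicator_apply, Set.mem_Iic, Set.mem_Ici]
  have hset : Set.Icc (-R) R ∩ Set.Ici t = Set.Icc t R := by
    ext s
    simp only [Set.mem_inter_iff, Set.mem_Icc, Set.mem_Ici]
    exact ⟨fun h => ⟨h.2, h.1.2⟩, fun h => ⟨⟨ht.1.trans h.1, h.2⟩, h.1⟩⟩
  simp only [h1]
  rw [setIntegral_indicator measurableSet_Ici, hset, integral_Icc_eq_integral_Ioc,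
    ← intervalIntegral.integral_of_le ht.2,
    intervalIntegral.integral_deriv_eq_sub (fun x _ => hφ.differentiable one_ne_zero x)
      ((hφ.continuous_deriv le_rfl).intervalIntegrable _ _), hR]
  ring

theorem oscOp_eq_integral_parabExt {lam R M : ℝ} {ψ : ℝ × ℝ × ℝ → ℂ} (hψ : ContDiff ℝ 1 ψ)
    (hsupp : ∀ x y t : ℝ, ψ (x, y, t) ≠ 0 →
      x ∈ Set.Ioo (-R) R ∧ y ∈ Set.Ioo (-R) R ∧ t ∈ Set.Ioo (-R) R)
    (hM : ∀ x y t : ℝ, ‖deriv (fun s : ℝ => ψ (x, y, s)) t‖ ≤ M) {f : ℝ → ℂ}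
    (hf : Integrable f (volume.restrict (Set.Icc (-R) R))) (z : ℝ × ℝ) :
    oscOp lam ψ f z = -∫ s in Set.Icc (-R) R, deriv (fun s : ℝ => ψ (z.1, z.2, s)) s *
      parabExt lam R ((Set.Iic s).indicator f) z := by
  set ν := volume.restrict (Set.Icc (-R) R) with hν
  set φ : ℝ → ℂ := fun s => ψ (z.1, z.2, s) with hφdef
  have hφ : ContDiff ℝ 1 φ := hψ.comp (by fun_prop)
  have hφR : φ R = 0 := by
    by_contra h
    exact lt_irrefl _ (hsupp _ _ _ h).2.2.2
  set e : ℝ → ℂ := fun t => Complex.exp (Complex.I * ((lam * (z.1 ^ 2 * t + z.2 * t ^ 2) : ℝ) : ℂ))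
    with he
  have hem : Measurable e := by simp only [he]; fun_prop
  have hen : ∀ t, ‖e t‖ = 1 := fun t => by
    simp only [he]; rw [mul_comm, Complex.norm_exp_ofReal_mul_I]
  set G : ℝ → ℝ → ℂ := fun t s => (Set.Iic s).indicator (fun _ => deriv φ s) t * (e t * f t)
    with hG
  have hGint : Integrable (Function.uncurry G) (ν.prod ν) := by
    have hef : Integrable (fun t => e t * f t) ν :=
      hf.bdd_mul hem.aestronglyMeasurable (ae_of_all _ fun t => (hen t).le)
    refine Integrable.bdd_mul (c := M) (hef.comp_fst ν) ?_ (ae_of_all _ fun p => ?_)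
    · have hm : Measurable fun p : ℝ × ℝ => if p.1 ≤ p.2 then deriv φ p.2 else 0 :=
        Measurable.ite (measurableSet_le measurable_fst measurable_snd)
          ((measurable_deriv φ).comp measurable_snd) measurable_const
      exact hm.aestronglyMeasurable
    · refine (norm_indicator_le_norm_self _ _).trans (hM _ _ _)
  have hrestrict : oscOp lam ψ f z = ∫ t, e t * φ t * f t ∂ν := by
    rw [oscOp, hν, setIntegral_eq_integral_of_forall_compl_eq_zero]
    intro t ht
    have : φ t = 0 := by
      by_contra h
      exact ht (Set.Ioo_subset_Icc_self (hsupp _ _ _ h).2.2)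
    rw [this]; ring
  calc oscOp lam ψ f z = ∫ t, e t * φ t * f t ∂ν := hrestrict
    _ = ∫ t, -∫ s, G t s ∂ν ∂ν := by
      refine setIntegral_congr_fun measurableSet_Icc fun t ht => ?_
      simp only [hG]
      rw [integral_mul_const, cutoff_eq_neg_integral hφ hφR ht]
      ring
    _ = -∫ s, ∫ t, G t s ∂ν ∂ν := by rw [integral_neg, integral_integral_swap hGint]
    _ = _ := by
      congr 1
      refine integral_congr_ae (ae_of_all _ fun s => ?_)
      simp only [parabExt]
      rw [← integral_const_mul]
      refine integral_congr_ae (ae_of_all _ fun t => ?_)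
      simp only [hG, Set.indicator_apply]
      split_ifs
      · ring
      · simp

theorem stronglyMeasurable_parabExt_indicator (lam R : ℝ) {f : ℝ → ℂ} (hf : Measurable f) :
    StronglyMeasurable fun p : (ℝ × ℝ) × ℝ =>
      parabExt lam R ((Set.Iic p.2).indicator f) p.1 := by
  unfold parabExt
  refine StronglyMeasurable.integral_prod_right
    (f := fun (p : (ℝ × ℝ) × ℝ) (t : ℝ) =>
      Complex.exp (Complex.I * ((lam * (p.1.1 ^ 2 * t + p.1.2 * t ^ 2) : ℝ) : ℂ)) *
        (Set.Iic p.2).indicator f t) (Measurable.stronglyMeasurable ?_)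
  refine Measurable.mul (by fun_prop) ?_
  exact Measurable.ite (measurableSet_le measurable_snd (measurable_snd.comp measurable_fst))
    (hf.comp measurable_snd) measurable_const

theorem stronglyMeasurable_oscOp (lam : ℝ) {ψ : ℝ × ℝ × ℝ → ℂ} (hψ : Continuous ψ) {f : ℝ → ℂ}
    (hf : Measurable f) : StronglyMeasurable (oscOp lam ψ f) := by
  unfold oscOp
  refine StronglyMeasurable.integral_prod_right
    (f := fun (z : ℝ × ℝ) (t : ℝ) =>
      Complex.exp (Complex.I * ((lam * (z.1 ^ 2 * t + z.2 * t ^ 2) : ℝ) : ℂ)) *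
        ψ (z.1, z.2, t) * f t) (Measurable.stronglyMeasurable ?_)
  refine Measurable.mul (Measurable.mul (by fun_prop) ?_) (hf.comp measurable_snd)
  exact hψ.measurable.comp (by fun_prop)

/-- The constant in the `L⁴` bound for cutoffs supported in the cube `(-R, R)³` whose `t`-derivative
is bounded by `M`. -/
def oscConst (R M : ℝ) : ℝ≥0∞ :=
  ENNReal.ofReal M ^ 4 * ENNReal.ofReal (2 * R) ^ 4 *
    (ENNReal.ofReal (Real.exp (R ^ 2)) ^ 2 * extConst R)

theorem oscConst_lt_top (R M : ℝ) : oscConst R M < ⊤ :=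
  ENNReal.mul_lt_top (ENNReal.mul_lt_top (ENNReal.pow_lt_top ENNReal.ofReal_lt_top)
    (ENNReal.pow_lt_top ENNReal.ofReal_lt_top))
    (ENNReal.mul_lt_top (ENNReal.pow_lt_top ENNReal.ofReal_lt_top) (extConst_lt_top R))

/-- The upper bound for cutoffs controlled only through their support and their `t`-derivative. The
bound `setLIntegral_parabExt_le` is averaged over the sharp cutoffs `t ≤ s` with Hölder's
inequality. -/
theorem lintegral_oscOp_pow_four_le {lam R M : ℝ} (hl : 0 < lam) {ψ : ℝ × ℝ × ℝ → ℂ}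
    (hψ : ContDiff ℝ 1 ψ)
    (hsupp : ∀ x y t : ℝ, ψ (x, y, t) ≠ 0 →
      x ∈ Set.Ioo (-R) R ∧ y ∈ Set.Ioo (-R) R ∧ t ∈ Set.Ioo (-R) R)
    (hM : ∀ x y t : ℝ, ‖deriv (fun s : ℝ => ψ (x, y, s)) t‖ ≤ M) {f : ℝ → ℂ}
    (hfm : Measurable f) (hf : MemLp f 4) :
    ∫⁻ z, ‖oscOp lam ψ f z‖ₑ ^ 4 ≤
      oscConst R M * ENNReal.ofReal (lam ^ (-(3 / 2) : ℝ)) * ∫⁻ t, ‖f t‖ₑ ^ 4 := by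
  set ν := volume.restrict (Set.Icc (-R) R) with hν
  set B := Set.Icc (-R) R ×ˢ Set.Icc (-R) R with hB
  set L := ENNReal.ofReal (lam ^ (-(3 / 2) : ℝ)) with hL
  set c := ENNReal.ofReal (Real.exp (R ^ 2)) ^ 2 * extConst R with hc
  set E : ℝ × ℝ → ℝ → ℂ := fun z s => parabExt lam R ((Set.Iic s).indicator f) z with hE
  have hfi : Integrable f ν := (hf.restrict _).integrable (by norm_num)
  have hEm : Measurable fun p : (ℝ × ℝ) × ℝ => ‖E p.1 p.2‖ₑ :=
    (stronglyMeasurable_parabExt_indicator lam R hfm).measurable.enorm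
  have hzero : ∀ z ∉ B, oscOp lam ψ f z = 0 := by
    intro z hz
    rw [oscOp]
    refine integral_eq_zero_of_ae (ae_of_all _ fun t => ?_)
    have : ψ (z.1, z.2, t) = 0 := by
      by_contra h
      have := hsupp _ _ _ h
      exact hz ⟨Set.Ioo_subset_Icc_self this.1, Set.Ioo_subset_Icc_self this.2.1⟩
    simp [this]
  have hBm : MeasurableSet B := measurableSet_Icc.prod measurableSet_Icc
  have huniv : ν Set.univ = ENNReal.ofReal (2 * R) := by
    rw [hν, Measure.restrict_apply_univ, Real.volume_Icc]; congr 1; ring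
  have hosc : ∀ z, oscOp lam ψ f z =
      -∫ s, deriv (fun s : ℝ => ψ (z.1, z.2, s)) s * E z s ∂ν :=
    oscOp_eq_integral_parabExt hψ hsupp hM hfi
  have hs : ∀ s, ∫⁻ z in B, ‖E z s‖ₑ ^ 4 ≤ c * L * ∫⁻ t, ‖f t‖ₑ ^ 4 := by
    intro s
    refine (setLIntegral_parabExt_le hl (hfi.indicator measurableSet_Iic)).trans ?_
    rw [hc]
    refine mul_le_mul' le_rfl
      ((setLIntegral_le_lintegral _ _).trans (lintegral_mono fun t => ?_))
    gcongr
    exact enorm_indicator_le_enorm_self _ _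
  clear_value E
  have hEz : ∀ z, Measurable fun s => ‖E z s‖ₑ := fun z => hEm.comp measurable_prodMk_left
  have hpt : ∀ z, ‖oscOp lam ψ f z‖ₑ ≤ ENNReal.ofReal M * ∫⁻ s, ‖E z s‖ₑ ∂ν := by
    intro z
    rw [hosc, enorm_neg, ← lintegral_const_mul _ (hEz z)]
    refine (enorm_integral_le_lintegral_enorm _).trans (lintegral_mono fun s => ?_)
    rw [enorm_mul]
    gcongr
    rw [← ofReal_norm]
    exact ENNReal.ofReal_le_ofReal (hM _ _ _)
  calc ∫⁻ z, ‖oscOp lam ψ f z‖ₑ ^ 4 = ∫⁻ z in B, ‖oscOp lam ψ f z‖ₑ ^ 4 := by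
        rw [← lintegral_indicator hBm]
        refine lintegral_congr fun z => ?_
        by_cases hz : z ∈ B
        · rw [Set.indicator_of_mem hz]
        · rw [Set.indicator_of_notMem hz, hzero z hz]; simp
    _ ≤ ∫⁻ z in B, ENNReal.ofReal M ^ 4 * ENNReal.ofReal (2 * R) ^ 3 * ∫⁻ s, ‖E z s‖ₑ ^ 4 ∂ν := by
        refine lintegral_mono fun z => ?_
        refine (pow_le_pow_left' (hpt z) 4).trans ?_
        rw [mul_pow, mul_assoc, ← huniv]
        gcongr
        exact lintegral_pow_four_le ν (hEz z).aemeasurable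
    _ = ENNReal.ofReal M ^ 4 * ENNReal.ofReal (2 * R) ^ 3 *
          ∫⁻ s, (∫⁻ z in B, ‖E z s‖ₑ ^ 4) ∂ν := by
        rw [lintegral_const_mul, lintegral_lintegral_swap]
        · exact (hEm.pow_const 4).aemeasurable
        · exact (hEm.pow_const 4).lintegral_prod_right' (ν := ν)
    _ ≤ ENNReal.ofReal M ^ 4 * ENNReal.ofReal (2 * R) ^ 3 *
          ∫⁻ _, (c * L * ∫⁻ t, ‖f t‖ₑ ^ 4) ∂ν := by
        gcongr with s
        exact hs s
    _ = _ := by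
        rw [lintegral_const, huniv, oscConst]
        ring

theorem eLpNorm_four {α E : Type*} [MeasurableSpace α] [NormedAddCommGroup E] (μ : Measure α)
    (f : α → E) : eLpNorm f 4 μ = (∫⁻ a, ‖f a‖ₑ ^ 4 ∂μ) ^ (1 / 4 : ℝ) := by
  rw [eLpNorm_eq_lintegral_rpow_enorm_toReal (by norm_num) (by norm_num)]
  have e4 : ∀ x : ℝ≥0∞, x ^ (4 : ℝ) = x ^ 4 := fun x => by
    rw [← ENNReal.rpow_natCast]; norm_num
  simp [e4]

theorem oscOp_congr_ae (lam : ℝ) (ψ : ℝ × ℝ × ℝ → ℂ) {f g : ℝ → ℂ} (h : f =ᵐ[volume] g) :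
    oscOp lam ψ f = oscOp lam ψ g := by
  ext z
  refine integral_congr_ae ?_
  filter_upwards [h] with t ht
  rw [ht]

theorem memLp_oscOp_and_eLpNorm_le {lam R M : ℝ} (hl : 0 < lam) {ψ : ℝ × ℝ × ℝ → ℂ}
    (hψ : ContDiff ℝ 1 ψ)
    (hsupp : ∀ x y t : ℝ, ψ (x, y, t) ≠ 0 →
      x ∈ Set.Ioo (-R) R ∧ y ∈ Set.Ioo (-R) R ∧ t ∈ Set.Ioo (-R) R)
    (hM : ∀ x y t : ℝ, ‖deriv (fun s : ℝ => ψ (x, y, s)) t‖ ≤ M) {f : ℝ → ℂ} (hf : MemLp f 4) :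
    MemLp (oscOp lam ψ f) 4 volume ∧ eLpNorm (oscOp lam ψ f) 4 volume ≤
      ENNReal.ofReal ((oscConst R M ^ (1 / 4 : ℝ)).toReal * lam ^ (-(3 / 8) : ℝ)) *
        eLpNorm f 4 volume := by
  have hbound : eLpNorm (oscOp lam ψ f) 4 volume ≤
      ENNReal.ofReal ((oscConst R M ^ (1 / 4 : ℝ)).toReal * lam ^ (-(3 / 8) : ℝ)) *
        eLpNorm f 4 volume := by
    have hK : oscConst R M ^ (1 / 4 : ℝ) ≠ ⊤ :=
      (ENNReal.rpow_lt_top_of_nonneg (by norm_num) (oscConst_lt_top R M).ne).ne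
    obtain ⟨g, hgm, hfg⟩ := hf.1
    rw [oscOp_congr_ae lam ψ hfg, eLpNorm_congr_ae hfg, eLpNorm_four,
      eLpNorm_four, ENNReal.ofReal_mul ENNReal.toReal_nonneg, ENNReal.ofReal_toReal hK]
    have h := lintegral_oscOp_pow_four_le hl hψ hsupp hM hgm.measurable
      ((memLp_congr_ae hfg).1 hf)
    refine (ENNReal.rpow_le_rpow h (by norm_num : (0 : ℝ) ≤ 1 / 4)).trans (le_of_eq ?_)
    rw [ENNReal.mul_rpow_of_nonneg _ _ (by norm_num), ENNReal.mul_rpow_of_nonneg _ _ (by norm_num),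
      ENNReal.ofReal_rpow_of_pos (by positivity), ← Real.rpow_mul hl.le]
    norm_num
  refine ⟨⟨?_, hbound.trans_lt (ENNReal.mul_lt_top ENNReal.ofReal_lt_top hf.2)⟩, hbound⟩
  rw [oscOp_congr_ae lam ψ hf.1.ae_eq_mk]
  exact (stronglyMeasurable_oscOp lam hψ.continuous
    hf.1.stronglyMeasurable_mk.measurable).aestronglyMeasurable

/-! ### The two upper bounds and sharpness -/

theorem exists_support_and_deriv_bound {ψ : ℝ × ℝ × ℝ → ℂ} (hψ : ContDiff ℝ ∞ ψ)
    (hc : HasCompactSupport ψ) :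
    ∃ R M : ℝ, (∀ x y t : ℝ, ψ (x, y, t) ≠ 0 →
      x ∈ Set.Ioo (-R) R ∧ y ∈ Set.Ioo (-R) R ∧ t ∈ Set.Ioo (-R) R) ∧
      ∀ x y t : ℝ, ‖deriv (fun s : ℝ => ψ (x, y, s)) t‖ ≤ M := by
  obtain ⟨R, hR⟩ := hc.isCompact.isBounded.subset_ball 0
  obtain ⟨M, hM⟩ := (hψ.continuous_fderiv (by simp)).bounded_above_of_compact_support
    (hc.fderiv (𝕜 := ℝ))
  refine ⟨R, M, fun x y t h => ?_, fun x y t => ?_⟩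
  · have h1 := hR (subset_tsupport ψ h)
    rw [mem_ball_zero_iff, Prod.norm_def, Prod.norm_def, max_lt_iff, max_lt_iff] at h1
    exact ⟨abs_lt.1 h1.1, abs_lt.1 h1.2.1, abs_lt.1 h1.2.2⟩
  · have h1 : HasDerivAt (fun s : ℝ => (x, y, s)) (0, 0, 1) t :=
      (hasDerivAt_const t x).prodMk ((hasDerivAt_const t y).prodMk (hasDerivAt_id t))
    have h2 : HasDerivAt (fun s : ℝ => ψ (x, y, s)) (fderiv ℝ ψ (x, y, t) (0, 0, 1)) t :=
      ((hψ.differentiable (by simp)) (x, y, t)).hasFDerivAt.comp_hasDerivAt t h1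
    rw [h2.deriv]
    calc ‖fderiv ℝ ψ (x, y, t) (0, 0, 1)‖ ≤ ‖fderiv ℝ ψ (x, y, t)‖ * ‖((0, 0, 1) : ℝ × ℝ × ℝ)‖ :=
          ContinuousLinearMap.le_opNorm _ _
      _ ≤ M * 1 := by
          gcongr
          · exact (norm_nonneg _).trans (hM 0)
          · exact hM _
          · simp [Prod.norm_def]
      _ = M := mul_one M

theorem support_subset_of_mem_cutoffClass {ψ : ℝ × ℝ × ℝ → ℂ} (hψ : ψ ∈ cutoffClass)
    (x y t : ℝ) (h : ψ (x, y, t) ≠ 0) :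
    x ∈ Set.Ioo (-2 : ℝ) 2 ∧ y ∈ Set.Ioo (-2 : ℝ) 2 ∧ t ∈ Set.Ioo (-2 : ℝ) 2 := by
  have hsub : Set.Icc (-1 : ℝ) 1 ⊆ Set.Ioo (-2) 2 := Set.Icc_subset_Ioo (by norm_num) (by norm_num)
  obtain ⟨hx, hy, ht⟩ := hψ.2.1 (subset_tsupport ψ h)
  exact ⟨hsub hx, hsub hy, hsub ht⟩

/-- The radius `2` leaves room for the vanishing of `ψ` at the end of the `t`-interval, and of the
derivative bounds defining `cutoffClass` only the one with `j = 1` is needed. -/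
theorem oscSup_four_le {lam : ℝ} (hl : 0 < lam) :
    oscSup 4 lam ≤
      ENNReal.ofReal ((oscConst 2 1 ^ (1 / 4 : ℝ)).toReal * lam ^ (-(3 / 8) : ℝ)) := by
  refine iSup₂_le fun ψ hψ => iSup₂_le fun f hf => ?_
  refine (memLp_oscOp_and_eLpNorm_le hl (hψ.1.of_le (by simp))
    (support_subset_of_mem_cutoffClass hψ) (M := 1) (fun x y t => ?_) hf.1).2.trans
    (mul_le_of_le_one_right' hf.2)
  have := hψ.2.2 1 (by simp) x y t
  rwa [iteratedDeriv_one] at this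

theorem eLpNorm_four_pow {α E : Type*} [MeasurableSpace α] [NormedAddCommGroup E] (μ : Measure α)
    (f : α → E) : eLpNorm f 4 μ ^ 4 = ∫⁻ a, ‖f a‖ₑ ^ 4 ∂μ := by
  rw [eLpNorm_four, ← ENNReal.rpow_natCast, ← ENNReal.rpow_mul]
  norm_num

/-- On the box `|x| ≤ lam ^ (-1/2)`, `|y| ≤ lam⁻¹` the phase is less than `1`, so that there is no
cancellation. -/
theorem one_quarter_le_norm_oscOp {ψ : ℝ × ℝ × ℝ → ℂ} (hψ : IsTestCutoff ψ) {lam : ℝ}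
    (hl : 16 ≤ lam) {z : ℝ × ℝ} (hx : lam * z.1 ^ 2 ≤ 1) (hy : lam * |z.2| ≤ 1) :
    1 / 4 ≤ ‖oscOp lam ψ ((Set.Icc (-(1 / 4)) (1 / 4)).indicator fun _ => 1) z‖ := by
  set I := Set.Icc (-(1 / 4) : ℝ) (1 / 4) with hI
  set p : ℝ → ℝ := fun t => lam * (z.1 ^ 2 * t + z.2 * t ^ 2) with hp
  have hIm : MeasurableSet I := measurableSet_Icc
  have hosc : oscOp lam ψ (I.indicator fun _ => 1) z =
      ∫ t in I, Complex.exp (Complex.I * (p t : ℂ)) := by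
    rw [oscOp, ← integral_indicator hIm]
    refine integral_congr_ae (ae_of_all _ fun t => ?_)
    by_cases ht : t ∈ I
    · have h1 : ψ (z.1, z.2, t) = 1 := by
        refine hψ.eq_one _ _ _ ?_
        rw [Real.sqrt_le_left (by norm_num)]
        -- `16 ≤ lam` keeps `(x, y, t)` within the ball of radius `1/2`, where `ψ = 1`.
        have hx2 : z.1 ^ 2 ≤ 1 / 16 := by nlinarith [sq_nonneg z.1]
        have hy2 : |z.2| ≤ 1 / 16 := by nlinarith [abs_nonneg z.2]
        have hy3 : z.2 ^ 2 ≤ 1 / 16 := by rw [← sq_abs]; nlinarith [abs_nonneg z.2]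
        have ht2 : t ^ 2 ≤ 1 / 16 := by nlinarith [ht.1, ht.2]
        linarith
      simp only [Set.indicator_of_mem ht, h1, hp]
      ring
    · simp only [Set.indicator_of_notMem ht, mul_zero]
  have hpc : Continuous p := by simp only [hp]; fun_prop
  have hint : IntegrableOn (fun t => Complex.exp (Complex.I * (p t : ℂ))) I :=
    (by fun_prop : Continuous fun t => Complex.exp (Complex.I * (p t : ℂ))).continuousOn
      |>.integrableOn_compact isCompact_Icc
  have hre : ∀ t, (Complex.exp (Complex.I * (p t : ℂ))).re = Real.cos (p t) := fun t => by
    rw [mul_comm, Complex.exp_ofReal_mul_I_re]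
  have hcos : ∀ t ∈ I, 1 / 2 ≤ Real.cos (p t) := by
    intro t ht
    have ht1 : |t| ≤ 1 / 4 := abs_le.2 ht
    have h1 : |p t| ≤ 1 := by
      calc |p t| = |(lam * z.1 ^ 2) * t + (lam * z.2) * t ^ 2| := by simp only [hp]; congr 1; ring
        _ ≤ |(lam * z.1 ^ 2) * t| + |(lam * z.2) * t ^ 2| := abs_add_le _ _
        _ = (lam * z.1 ^ 2) * |t| + (lam * |z.2|) * |t| ^ 2 := by
            rw [abs_mul (lam * z.1 ^ 2) t, abs_mul (lam * z.2), abs_mul lam z.2,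
              abs_of_nonneg (by positivity : 0 ≤ lam * z.1 ^ 2),
              abs_of_pos (by linarith : 0 < lam), abs_pow]
        _ ≤ 1 * (1 / 4) + 1 * (1 / 4) ^ 2 := by gcongr
        _ ≤ 1 := by norm_num
    have h2 := Real.one_sub_sq_div_two_le_cos (x := p t)
    have h3 : p t ^ 2 ≤ 1 := by rw [← sq_abs]; nlinarith [abs_nonneg (p t)]
    linarith
  rw [hosc]
  refine le_trans ?_ (Complex.re_le_norm _)
  have hreint : (∫ t in I, Complex.exp (Complex.I * (p t : ℂ))).re = ∫ t in I, Real.cos (p t) := by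
    have := integral_re hint
    simp only [RCLike.re_eq_complex_re, hre] at this
    exact this.symm
  rw [hreint]
  calc (1 / 4 : ℝ) = ∫ _ in I, (1 / 2 : ℝ) := by
        rw [setIntegral_const, hI, Measure.real, Real.volume_Icc, ENNReal.toReal_ofReal (by norm_num)]
        norm_num
    _ ≤ _ := by
        refine setIntegral_mono_on ?_ ?_ measurableSet_Icc hcos
        · exact integrableOn_const (by simp [hI])
        · exact (by fun_prop : Continuous fun t => Real.cos (p t)).continuousOn
            |>.integrableOn_compact isCompact_Icc

theorem le_lintegral_oscOp {ψ : ℝ × ℝ × ℝ → ℂ} (hψ : IsTestCutoff ψ) {lam : ℝ} (hl : 16 ≤ lam) :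
    ENNReal.ofReal (1 / 64 * lam ^ (-(3 / 2) : ℝ)) ≤
      ∫⁻ z, ‖oscOp lam ψ ((Set.Icc (-(1 / 4)) (1 / 4)).indicator fun _ => 1) z‖ₑ ^ 4 := by
  have hl0 : 0 < lam := by linarith
  set u := lam ^ (-(1 / 2) : ℝ) with hu
  have hu0 : 0 < u := by positivity
  have hu2 : lam * u ^ 2 = 1 := by
    rw [hu, ← Real.rpow_natCast, ← Real.rpow_mul hl0.le]
    norm_num [Real.rpow_neg_one, hl0.ne']
  have hu3 : u ^ 3 = lam ^ (-(3 / 2) : ℝ) := by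
    rw [hu, ← Real.rpow_natCast, ← Real.rpow_mul hl0.le]; norm_num
  set B := Set.Icc (-u) u ×ˢ Set.Icc (-u ^ 2) (u ^ 2)
  have hvol : volume B = ENNReal.ofReal (4 * u ^ 3) := by
    rw [Measure.volume_eq_prod, Measure.prod_prod, Real.volume_Icc, Real.volume_Icc,
      ← ENNReal.ofReal_mul (by linarith)]
    congr 1; ring
  calc ENNReal.ofReal (1 / 64 * lam ^ (-(3 / 2) : ℝ))
      = ENNReal.ofReal (1 / 4) ^ 4 * volume B := by
        rw [hvol, ← hu3, ← ENNReal.ofReal_pow (by norm_num), ← ENNReal.ofReal_mul (by norm_num)]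
        congr 1; ring
    _ = ∫⁻ _ in B, ENNReal.ofReal (1 / 4) ^ 4 := by rw [setLIntegral_const]
    _ ≤ ∫⁻ z in B, ‖oscOp lam ψ ((Set.Icc (-(1 / 4)) (1 / 4)).indicator fun _ => 1) z‖ₑ ^ 4 := by
        refine setLIntegral_mono' (measurableSet_Icc.prod measurableSet_Icc) fun z hz => ?_
        refine pow_le_pow_left' ?_ 4
        rw [← ofReal_norm]
        refine ENNReal.ofReal_le_ofReal (one_quarter_le_norm_oscOp hψ hl ?_ ?_)
        · rw [← hu2]
          have : |z.1| ≤ |u| := by rw [abs_of_pos hu0]; exact abs_le.2 hz.1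
          have := sq_le_sq.2 this
          gcongr
        · rw [← hu2]
          have : |z.2| ≤ u ^ 2 := abs_le.2 hz.2
          gcongr
    _ ≤ _ := setLIntegral_le_lintegral _ _

theorem decay_exponent_le {ψ : ℝ × ℝ × ℝ → ℂ} (hψ : IsTestCutoff ψ) {δ C : ℝ}
    (h : ∀ᶠ lam : ℝ in atTop, ∀ f : ℝ → ℂ, MemLp f 4 volume →
        eLpNorm (oscOp lam ψ f) 4 volume ≤
          ENNReal.ofReal (C * lam ^ (-δ)) * eLpNorm f 4 volume) : δ ≤ 3 / 8 := by
  by_contra! hδ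
  have hgrow := (tendsto_rpow_atTop (by linarith : 0 < 4 * δ - 3 / 2)).eventually_gt_atTop
    (32 * C ^ 4)
  obtain ⟨lam, hlam, hl, hgt⟩ := (h.and ((eventually_ge_atTop 16).and hgrow)).exists
  have hl0 : 0 < lam := by linarith
  set f : ℝ → ℂ := (Set.Icc (-(1 / 4)) (1 / 4)).indicator fun _ => 1 with hf
  have hfm : MemLp f 4 volume := memLp_indicator_const 4 measurableSet_Icc 1 (Or.inr (by simp))
  have hnorm : eLpNorm f 4 volume ^ 4 = ENNReal.ofReal (1 / 2) := by
    have e : ∀ t, ‖f t‖ₑ ^ 4 = (Set.Icc (-(1 / 4) : ℝ) (1 / 4)).indicator (fun _ => 1) t := by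
      intro t
      simp only [hf, Set.indicator_apply]
      split_ifs <;> simp
    rw [eLpNorm_four_pow]
    simp only [e]
    rw [lintegral_indicator measurableSet_Icc, setLIntegral_one, Real.volume_Icc]
    congr 1; norm_num
  have h4 : ENNReal.ofReal (1 / 64 * lam ^ (-(3 / 2) : ℝ)) ≤
      ENNReal.ofReal (|C * lam ^ (-δ)| ^ 4 * (1 / 2)) := by
    calc _ ≤ eLpNorm (oscOp lam ψ f) 4 volume ^ 4 := by
          rw [eLpNorm_four_pow]; exact le_lintegral_oscOp hψ hl
      _ ≤ (ENNReal.ofReal |C * lam ^ (-δ)| * eLpNorm f 4 volume) ^ 4 := by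
          refine pow_le_pow_left' ((hlam f hfm).trans ?_) 4
          gcongr
          exact le_abs_self _
      _ = _ := by
          rw [mul_pow, hnorm, ENNReal.ofReal_mul (by positivity),
            ENNReal.ofReal_pow (abs_nonneg _)]
  have h5 := (ENNReal.ofReal_le_ofReal_iff (by positivity)).1 h4
  have e1 : |C * lam ^ (-δ)| ^ 4 = C ^ 4 * lam ^ (-(4 * δ)) := by
    rw [Even.pow_abs (by decide), mul_pow, ← Real.rpow_natCast (lam ^ (-δ)), ← Real.rpow_mul hl0.le]
    congr 2; push_cast; ring
  have e2 : lam ^ (-(3 / 2) : ℝ) = lam ^ (4 * δ - 3 / 2) * lam ^ (-(4 * δ)) := by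
    rw [← Real.rpow_add hl0]; congr 1; ring
  rw [e1, e2] at h5
  have hp : 0 < lam ^ (-(4 * δ)) := by positivity
  nlinarith [mul_lt_mul_of_pos_right hgt hp]

end

theorem theorem1 :
    -- the decay estimate for an arbitrary smooth compactly supported cutoff
    (∀ ψ : ℝ × ℝ × ℝ → ℂ, ContDiff ℝ ∞ ψ → HasCompactSupport ψ →
      ∃ C : ℝ, ∀ lam : ℝ, 0 < lam → ∀ f : ℝ → ℂ, MemLp f 4 volume →
        MemLp (oscOp lam ψ f) 4 volume ∧
        eLpNorm (oscOp lam ψ f) 4 volume ≤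
          ENNReal.ofReal (C * lam ^ (-(3 / 8) : ℝ)) * eLpNorm f 4 volume) ∧
    -- the uniform form over the class of normalized cutoffs
    (∃ C : ℝ, ∀ lam : ℝ, 0 < lam →
      oscSup 4 lam ≤ ENNReal.ofReal (C * lam ^ (-(3 / 8) : ℝ))) ∧
    -- sharpness of the exponent
    (∀ ψ : ℝ × ℝ × ℝ → ℂ, IsTestCutoff ψ → ∀ δ C : ℝ,
      (∀ᶠ lam : ℝ in atTop, ∀ f : ℝ → ℂ, MemLp f 4 volume →
        eLpNorm (oscOp lam ψ f) 4 volume ≤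
          ENNReal.ofReal (C * lam ^ (-δ)) * eLpNorm f 4 volume) →
      δ ≤ 3 / 8) := by
  refine ⟨fun ψ hψ hc => ?_, ⟨_, fun lam hl => oscSup_four_le hl⟩,
    fun ψ hψ δ C h => decay_exponent_le hψ h⟩
  obtain ⟨R, M, hsupp, hM⟩ := exists_support_and_deriv_bound hψ hc
  exact ⟨_, fun lam hl f hf => memLp_oscOp_and_eLpNorm_le hl (hψ.of_le (by simp)) hsupp hM hf⟩
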